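/- Let $n$ sensors have outputs $y_i(t)=\alpha_i x(t)+\beta_i$, $i=1,\dots,n$, with constants $\alpha_i\neq 0$ and $\beta_i$. Let $\mathcal G$ be a digraph on $\{1,\dots,n\}$ that contains a spanning tree (a directed tree with a root from which every node is reachable), let $\mathcal N_i$ be the set of nodes $j$ with an arc $j\to i$, and let $\gamma_{ij}>0$ for $j\in\mathcal N_i$ and $\gamma_{ij}=0$ otherwise. Assume: (a) $x(t)$, $t=0,1,2,\dots$, are i.i.d. with mean $\bar x$, second moment $s^2$, $s^2-\bar x^2>0$ and $E\{x(t)^4\}<\infty$; (b) for each pair $(i,j)$, the $u_{ij}(t)$, $t\ge 0$, are i.i.d., equal to $1$ with probability $p_{ij}$ and to $0$ with probability $1-p_{ij}$, where $p_{ij}>0$ when $j\in\mathcal N_i$ (communication dropouts); put $\gamma_{ij}(t)=u_{ij}(t)\gamma_{ij}$; (c) for each pair $(i,j)$, the $\xi_{ij}(t)$, $t\ge0$, are i.i.d. with zero mean and finite variance (communication noise); (d) the processes $\{x(t)\}$, $\{u_{ij}(t)\}$, $\{\xi_{ij}(t)\}$ (over all pairs $(i,j)$) are mutually independent; (e) $\delta(t)>0$,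 $\sum_{t=0}^\infty\delta(t)=\infty$, $\sum_{t=0}^\infty\delta(t)^2<\infty$. For weights $g=(g_{ij})$ let $\Gamma(g)$ be the $n\times n$ matrix with off-diagonal entries $g_{ij}$ and diagonal entries $-\sum_{j\ne i}g_{ij}$. Let $$\Phi_i(t)=\begin{bmatrix}\alpha_i y_i(t)x(t)&\alpha_i y_i(t)\\ (1+\beta_i y_i(t))x(t)&1+\beta_i y_i(t)\end{bmatrix},\qquad \nu_i(t)=\sum_{j\in\mathcal N_i}\gamma_{ij}(t)\xi_{ij}(t)\begin{bmatrix}\alpha_i y_i(t)\\ 1+\beta_i y_i(t)\end{bmatrix},$$ $$B'(t)=\mathrm{diag}\{\Phi_1(t),\dots,\Phi_n(t)\}\,\big(\Gamma((\gamma_{ij}(t)))\otimes I_2\big),$$ $$\bar B'=E\{B'(t)\}=\mathrm{diag}\{E\Phi_1(t),\dots,E\Phi_n(t)\}\,\big(\Gamma((\gamma_{ij}p_{ij}))\otimes I_2\big),$$ and $\nu(t)=[\nu_1(t)^T\cdots\nu_n(t)^T]^T$. Let $\hat\rho(t)\in\mathbb R^{2n}$ be generated by $$\hat\rho(t+1)=(I+\delta(t)B'(t))\hat\rho(t)+\delta(t)\nu(t)=(I+\delta(t)\bar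 B')\hat\rho(t)+\delta(t)\big(B'(t)-\bar B'\big)\hat\rho(t)+\delta(t)\nu(t),$$ with $\hat\rho(0)=[\alpha_1\ \beta_1\ \cdots\ \alpha_n\ \beta_n]^T$. Let $i_1=[1\ 0\ 1\ 0\cdots1\ 0]^T$ and $i_2=[0\ 1\ 0\ 1\cdots0\ 1]^T$ in $\mathbb R^{2n}$. Let $T'=[\,i_1\ \ i_2\ \ T_0\,]$, where $T_0$ is any $2n\times(2n-2)$ matrix whose column space is that of $\bar B'$. Such a $T_0$ exists, $T'$ is nonsingular, and the first two rows $\pi_1',\pi_2'$ of $(T')^{-1}$ are left eigenvectors of $\bar B'$ for the eigenvalue $0$. Then there are square-integrable scalar random variables $w_1,w_2$ such that $\hat\rho(t)$ converges to $i_1w_1+i_2w_2$ as $t\to\infty$, both in mean square and with probability one, and $$E\{w_1\}=\pi_1'\hat\rho(0),\qquad E\{w_2\}=\pi_2'\hat\rho(0).$$ -/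

import Mathlib

open MeasureTheory ProbabilityTheory Filter Topology
open scoped Matrix Kronecker

noncomputable section

namespace BlindCalibration

/-- `T` is a directed tree, rooted at `r`, on the whole vertex set: the root has no parent, every
other vertex has exactly one parent, and every vertex is reachable from the root. -/
structure IsSpanningTreeAt {V : Type*} (T : Digraph V) (r : V) : Prop where
  root_no_parent : ∀ v, ¬ T.Adj v r
  unique_parent : ∀ v, v ≠ r → ∃! w, T.Adj w v
  reachable : ∀ v, Relation.ReflTransGen T.Adj r v

/-- A digraph has a spanning tree if one of its sub-digraphs is a rooted directed tree on all of
its vertices. -/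
def HasSpanningTree {V : Type*} (G : Digraph V) : Prop :=
  ∃ T : Digraph V, T ≤ G ∧ ∃ r : V, IsSpanningTreeAt T r

/-- Output `y = α x + β` of a sensor with gain `α` and offset `β`. -/
def sensorOutput (α β x : ℝ) : ℝ := α * x + β

/-- The `2 × 2` matrix `Φᵢ(t)` of a sensor with gain `α` and offset `β`, for the signal value
`x = x(t)`. -/
def Phi (α β x : ℝ) : Matrix (Fin 2) (Fin 2) ℝ :=
  !![α * sensorOutput α β x * x, α * sensorOutput α β x;
     (1 + β * sensorOutput α β x) * x, 1 + β * sensorOutput α β x]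

/-- The mean of `Phi α β x` when the signal has mean `m` and second moment `s2`. -/
def PhiBar (α β m s2 : ℝ) : Matrix (Fin 2) (Fin 2) ℝ :=
  !![α * β * m + α ^ 2 * s2, α * β + α ^ 2 * m;
     (1 + β ^ 2) * m + α * β * s2, 1 + β ^ 2 + α * β * m]

/-- Block diagonal matrix with the `2 × 2` blocks `M i`. The index `(i, k)` is the `k`-th
coordinate of the `i`-th block. -/
def blockDiag {n : ℕ} (M : Fin n → Matrix (Fin 2) (Fin 2) ℝ) :
    Matrix (Fin n × Fin 2) (Fin n × Fin 2) ℝ :=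
  Matrix.of fun p q => if p.1 = q.1 then M p.1 p.2 q.2 else 0

/-- The matrix `Γ` built from weights `g`: off-diagonal entries `g i j`, diagonal entries
`- ∑_{j ≠ i} g i j`. -/
def Gam {n : ℕ} (g : Fin n → Fin n → ℝ) : Matrix (Fin n) (Fin n) ℝ :=
  Matrix.of fun i j => if i = j then - ∑ k ∈ Finset.univ.erase i, g i k else g i j

/-- `B'(t) = Φ(t) (Γ(t) ⊗ I₂)`, for the signal value `x = x(t)` and the current weights `g`. -/
def Bmat {n : ℕ} (α β : Fin n → ℝ) (g : Fin n → Fin n → ℝ) (x : ℝ) :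
    Matrix (Fin n × Fin 2) (Fin n × Fin 2) ℝ :=
  blockDiag (fun i => Phi (α i) (β i) x) * (Gam g ⊗ₖ (1 : Matrix (Fin 2) (Fin 2) ℝ))

/-- `B̄' = Φ̄ (Γ̄ ⊗ I₂)`, where `Γ̄` has the weights `γ i j * p i j`. -/
def BbarMat {n : ℕ} (α β : Fin n → ℝ) (γ p : Fin n → Fin n → ℝ) (m s2 : ℝ) :
    Matrix (Fin n × Fin 2) (Fin n × Fin 2) ℝ :=
  blockDiag (fun i => PhiBar (α i) (β i) m s2) *
    (Gam (fun i j => γ i j * p i j) ⊗ₖ (1 : Matrix (Fin 2) (Fin 2) ℝ))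

/-- The noise term `ν(t)`, for the signal value `x`, the current weights `g` and the communication
noises `ξ`. Weights of absent links vanish, so the sum runs over the neighbors of `i`. -/
def noiseVec {n : ℕ} (α β : Fin n → ℝ) (g ξ : Fin n → Fin n → ℝ) (x : ℝ) : Fin n × Fin 2 → ℝ :=
  fun p => (∑ j, g p.1 j * ξ p.1 j) *
    (![α p.1 * sensorOutput (α p.1) (β p.1) x,
       1 + β p.1 * sensorOutput (α p.1) (β p.1) x] : Fin 2 → ℝ) p.2

/-- Initial value: `ρ̂ᵢ(0) = (αᵢ, βᵢ)`. -/
def rhoInit {n : ℕ} (α β : Fin n → ℝ) : Fin n × Fin 2 → ℝ :=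
  fun p => (![α p.1, β p.1] : Fin 2 → ℝ) p.2

/-- The recursion `ρ̂(t+1) = (I + δ(t) B'(t)) ρ̂(t) + δ(t) ν(t)` along one sample path `x`, `u`, `ξ`
of the signal, of the link indicators and of the communication noises; the weights at time `t` are
`u i j t * γ i j`. -/
def rhoHat {n : ℕ} (α β : Fin n → ℝ) (γ : Fin n → Fin n → ℝ) (δ : ℕ → ℝ)
    (x : ℕ → ℝ) (u ξ : Fin n → Fin n → ℕ → ℝ) : ℕ → Fin n × Fin 2 → ℝ
  | 0 => rhoInit α β
  | t + 1 =>
      (1 + δ t • Bmat α β (fun i j => u i j t * γ i j) (x t)) *ᵥ rhoHat α β γ δ x u ξ t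
        + δ t • noiseVec α β (fun i j => u i j t * γ i j) (fun i j => ξ i j t) (x t)

/-- The same recursion with `B'(t)` split into `B̄'` and `B̃'(t) = B'(t) - B̄'`. -/
theorem rhoHat_succ_split {n : ℕ} (α β : Fin n → ℝ) (γ p : Fin n → Fin n → ℝ) (m s2 : ℝ)
    (δ : ℕ → ℝ) (x : ℕ → ℝ) (u ξ : Fin n → Fin n → ℕ → ℝ) (t : ℕ) :
    rhoHat α β γ δ x u ξ (t + 1) =
      (1 + δ t • BbarMat α β γ p m s2) *ᵥ rhoHat α β γ δ x u ξ t
        + δ t • ((Bmat α β (fun i j => u i j t * γ i j) (x t) - BbarMat α β γ p m s2) *ᵥ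
            rhoHat α β γ δ x u ξ t)
        + δ t • noiseVec α β (fun i j => u i j t * γ i j) (fun i j => ξ i j t) (x t) := by
  rw [rhoHat, Matrix.add_mulVec, Matrix.add_mulVec, Matrix.smul_mulVec, Matrix.smul_mulVec,
    Matrix.sub_mulVec, smul_sub]
  abel

/-- The vectors `i₁ = (1,0,1,0,…)` (for `k = 0`) and `i₂ = (0,1,0,1,…)` (for `k = 1`). -/
def iVec (n : ℕ) (k : Fin 2) : Fin n × Fin 2 → ℝ := fun p => if p.2 = k then 1 else 0

/-- The matrix `[i₁ i₂ T₀]`. -/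
def transMat {n : ℕ} (T₀ : Matrix (Fin n × Fin 2) (Fin (2 * n - 2)) ℝ) :
    Matrix (Fin n × Fin 2) (Fin 2 ⊕ Fin (2 * n - 2)) ℝ :=
  Matrix.fromCols (Matrix.of fun p k => iVec n k p) T₀

/-- The family of all scalar processes: the signal, the link indicators and the communication
noises, each as a random sequence. -/
def processes {Ω : Type*} {n : ℕ} (x : ℕ → Ω → ℝ) (u ξ : Fin n → Fin n → ℕ → Ω → ℝ) :
    Unit ⊕ (Fin n × Fin n) ⊕ (Fin n × Fin n) → Ω → ℕ → ℝ
  | .inl _ => fun ω t => x t ω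
  | .inr (.inl e) => fun ω t => u e.1 e.2 t ω
  | .inr (.inr e) => fun ω t => ξ e.1 e.2 t ω

end BlindCalibration

end

/-! The recursion is a linear stochastic approximation: the mean matrix `B̄'` drives it, and the
rest is a square-integrable martingale difference.

Deterministic side. The mean of `Φᵢ` factors as `Aᵢ M`, with `Aᵢ` symmetric positive definite
because `αᵢ ≠ 0`, and `M` the second moment matrix of `(x, 1)`, positive definite because the
variance is positive. Testing block row `i` in the form of `Aᵢ⁻¹` turns `B̄'` into a weighted graph
Laplacian for the inner product of `M`. Maximum principles then show that the kernel is spanned by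
`i₁, i₂` (`ker_BbarMat`, where the spanning tree enters), that the range meets the kernel trivially
(`disjoint_range_iVec`), and that every nonzero eigenvalue has negative real part
(`eq_zero_of_BbarMat_eigen`). With `P` the projection onto the kernel along the range, `B̄' - P` is
Hurwitz and has a quadratic Lyapunov function `Q` (`exists_lyapunov`).

Stochastic side (`linear_stochastic_approximation`). Let `z = (1 - P) ρ`. Since every `B'(t)` kills
`i₁, i₂`, the noise `m` depends on the state only through `z`, so its variance is at most a constant
times `1 + E zᵀQz`. Hence `E zᵀQz` contracts at rate `δ` up to errors of order `δ²` and tends to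
zero. The noise variances are then bounded, and `∑ δ² < ∞` makes `∑ δ m` a martingale converging
almost surely and in mean square to some `L` with mean zero. As `P B̄' = 0`, the component `P ρ` is
`P (ρ(0) + ∑ δ m)`. Almost sure decay of `z` follows path by path once the converging noise is
subtracted. The limit is `P (ρ(0) + L)`, so `w k = π k ⬝ᵥ (ρ(0) + L)`, with mean `π k ⬝ᵥ ρ(0)`. -/

namespace BlindCalibration

/-! ### Scalar recursions with non-summable step sizes. -/

/-- A nonnegative sequence that contracts at rate `c δ t`, up to errors `δ t * ε t` with
`ε t → 0`, tends to zero as soon as the step sizes are not summable. -/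
theorem tendsto_zero_of_contraction {a δ ε : ℕ → ℝ} {c : ℝ} (hc : 0 < c) (ha : ∀ t, 0 ≤ a t)
    (hδ : ∀ t, 0 < δ t)
    (hsum : Tendsto (fun N => ∑ t ∈ Finset.range N, δ t) atTop atTop)
    (hδ0 : Tendsto δ atTop (𝓝 0)) (hε : Tendsto ε atTop (𝓝 0))
    (h : ∀ᶠ t in atTop, a (t + 1) ≤ (1 - c * δ t) * a t + δ t * ε t) :
    Tendsto a atTop (𝓝 0) := by
  rw [Metric.tendsto_atTop]
  intro η hη
  have h1 : ∀ᶠ t in atTop, c * δ t < 1 := by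
    have : Tendsto (fun t => c * δ t) atTop (𝓝 0) := by simpa using hδ0.const_mul c
    exact this.eventually_lt_const one_pos
  have h2 : ∀ᶠ t in atTop, ε t < c * (η / 2) := hε.eventually_lt_const (by positivity)
  obtain ⟨T, hT⟩ := eventually_atTop.1 (h.and (h1.and h2))
  -- The level `η / 2` is a fixed point of the recursion when `ε` is replaced by its bound `c * (η /
  -- 2)`; only the excess above it is damped, by the product of the factors `1 - c δ ≤ exp (-c δ)`.
  have key : ∀ k, a (T + k) ≤
      η / 2 + Real.exp (-(c * ∑ s ∈ Finset.range k, δ (T + s))) * a T := by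
    intro k
    induction k with
    | zero => simp; positivity
    | succ k ih =>
      obtain ⟨r1, r2, r3⟩ := hT (T + k) (by omega)
      have e1 : 1 - c * δ (T + k) ≤ Real.exp (-(c * δ (T + k))) := by
        have := Real.add_one_le_exp (-(c * δ (T + k)))
        linarith
      have e2 : Real.exp (-(c * ∑ s ∈ Finset.range (k + 1), δ (T + s))) =
          Real.exp (-(c * δ (T + k))) * Real.exp (-(c * ∑ s ∈ Finset.range k, δ (T + s))) := by
        rw [← Real.exp_add, Finset.sum_range_succ]
        ring_nf
      rw [e2]
      set E := Real.exp (-(c * ∑ s ∈ Finset.range k, δ (T + s)))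
      have hE : 0 ≤ E * a T := mul_nonneg (Real.exp_pos _).le (ha T)
      calc a (T + (k + 1)) ≤ (1 - c * δ (T + k)) * a (T + k) + δ (T + k) * ε (T + k) := r1
        _ ≤ (1 - c * δ (T + k)) * (η / 2 + E * a T) + δ (T + k) * (c * (η / 2)) := by
          have := (hδ (T + k)).le
          have : 0 ≤ 1 - c * δ (T + k) := by linarith
          gcongr
        _ = η / 2 + (1 - c * δ (T + k)) * (E * a T) := by ring
        _ ≤ η / 2 + Real.exp (-(c * δ (T + k))) * (E * a T) := by gcongr
        _ = _ := by ring
  have hs : Tendsto (fun k => ∑ s ∈ Finset.range k, δ (T + s)) atTop atTop := by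
    have : Tendsto (fun k => (∑ s ∈ Finset.range (k + T), δ s) - ∑ s ∈ Finset.range T, δ s)
        atTop atTop :=
      tendsto_atTop_add_const_right _ _ (hsum.comp (tendsto_add_atTop_nat T))
    refine this.congr fun k => ?_
    rw [add_comm, Finset.sum_range_add]
    ring
  have hlim : Tendsto (fun k => Real.exp (-(c * ∑ s ∈ Finset.range k, δ (T + s))) * a T)
      atTop (𝓝 0) := by
    have := (Real.tendsto_exp_neg_atTop_nhds_zero.comp (hs.const_mul_atTop hc)).mul_const (a T)
    simpa using this
  obtain ⟨K, hK⟩ := eventually_atTop.1 (hlim.eventually_lt_const (half_pos hη))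
  refine ⟨T + K, fun t ht => ?_⟩
  obtain ⟨k, rfl⟩ := Nat.exists_eq_add_of_le (le_trans (Nat.le_add_right T K) ht)
  rw [Real.dist_eq, sub_zero, abs_of_nonneg (ha _)]
  have := key k
  have := hK k (by omega)
  linarith

/-! ### Quadratic Lyapunov functions of Hurwitz matrices. -/

section Lyapunov

variable {ι : Type*} [Fintype ι]

theorem dotProduct_mulVec_le (M : Matrix ι ι ℝ) (v : ι → ℝ) :
    v ⬝ᵥ M *ᵥ v ≤ (∑ i, ∑ j, |M i j|) * (v ⬝ᵥ v) := by
  have hle : ∀ i, v i ^ 2 ≤ v ⬝ᵥ v := fun i => by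
    rw [dotProduct, sq]
    exact Finset.single_le_sum (f := fun i => v i * v i) (fun j _ => mul_self_nonneg _)
      (Finset.mem_univ i)
  simp only [dotProduct, Matrix.mulVec, Finset.mul_sum, Finset.sum_mul]
  simp only [← Finset.sum_mul, ← Finset.mul_sum]
  change ∑ i, v i * ∑ j, M i j * v j ≤ _ * (v ⬝ᵥ v)
  rw [Finset.sum_mul]
  simp only [Finset.mul_sum, Finset.sum_mul]
  refine Finset.sum_le_sum fun i _ => Finset.sum_le_sum fun j _ => ?_
  have h1 := hle i
  have h2 := hle j
  have h3 : |v i * v j| ≤ v ⬝ᵥ v := by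
    rw [abs_le]; constructor <;> nlinarith [sq_nonneg (v i + v j), sq_nonneg (v i - v j)]
  calc v i * (M i j * v j) ≤ |v i * (M i j * v j)| := le_abs_self _
    _ = |M i j| * |v i * v j| := by rw [← abs_mul]; ring_nf
    _ ≤ _ := by gcongr

variable [DecidableEq ι]

attribute [local instance] Matrix.linftyOpNormedRing Matrix.linftyOpNormedAlgebra

/-- The powers of a complex matrix whose eigenvalues lie in the open unit disc tend to zero. -/
theorem tendsto_pow_zero_of_eigenvalues [Nonempty ι] (S : Matrix ι ι ℂ)
    (hS : ∀ (z : ℂ) (v : ι → ℂ), v ≠ 0 → S *ᵥ v = z • v → ‖z‖ < 1) :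
    Tendsto (fun k => S ^ k) atTop (𝓝 0) := by
  have hr : spectralRadius ℂ S < 1 := by
    have := spectrum.spectralRadius_lt_of_forall_lt S (r := 1) (fun z hz => ?_)
    · simpa using this
    rw [← Matrix.spectrum_toLin', ← Module.End.hasEigenvalue_iff_mem_spectrum] at hz
    obtain ⟨v, hv⟩ := hz.exists_hasEigenvector
    have := hS z v hv.2 (by simpa using hv.apply_eq_smul)
    exact_mod_cast this
  obtain ⟨r, hr1, hr2⟩ := ENNReal.lt_iff_exists_nnreal_btwn.1 hr
  -- Gelfand's formula: a spectral radius below `r < 1` makes the powers eventually smaller than `r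
  -- ^ k`.
  have hg := spectrum.pow_nnnorm_pow_one_div_tendsto_nhds_spectralRadius S
  have hev := hg.eventually_lt_const hr1
  have hr2' : r < 1 := by exact_mod_cast hr2
  have hle : ∀ᶠ k : ℕ in atTop, ‖S ^ k‖ ≤ (r : ℝ) ^ k := by
    filter_upwards [hev, eventually_gt_atTop 0] with k hk hk0
    have h1 : (‖S ^ k‖₊ : ENNReal) < (r : ENNReal) ^ (k : ℝ) := by
      have := ENNReal.rpow_lt_rpow hk (z := (k : ℝ)) (by exact_mod_cast hk0)
      rwa [← ENNReal.rpow_mul, one_div, inv_mul_cancel₀ (by exact_mod_cast hk0.ne'),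
        ENNReal.rpow_one] at this
    rw [ENNReal.rpow_natCast] at h1
    have h2 : ‖S ^ k‖₊ < r ^ k := by exact_mod_cast h1
    exact_mod_cast h2.le
  exact squeeze_zero_norm' hle (tendsto_pow_atTop_nhds_zero_of_lt_one r.2 (by exact_mod_cast hr2'))

/-- A real matrix without eigenvalues in the closed right half plane (stated through the real and
imaginary parts of the eigenvectors) admits a quadratic Lyapunov function. -/
theorem exists_lyapunov [Nonempty ι] (A : Matrix ι ι ℝ)
    (hA : ∀ (σ τ : ℝ) (a b : ι → ℝ), 0 ≤ σ → A *ᵥ a = σ • a - τ • b → A *ᵥ b = τ • a + σ • b →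
      a = 0 ∧ b = 0) :
    ∃ Q : Matrix ι ι ℝ, Q.IsSymm ∧ (∀ v, v ⬝ᵥ v ≤ v ⬝ᵥ Q *ᵥ v) ∧
      ∃ c > 0, ∀ v, v ⬝ᵥ Q *ᵥ (A *ᵥ v) ≤ - c * (v ⬝ᵥ Q *ᵥ v) := by
  set C : Matrix ι ι ℂ := A.map Complex.ofReal with hC
  have hre : ∀ (v : ι → ℂ) i, ((C *ᵥ v) i).re = (A *ᵥ fun j => (v j).re) i := by
    intro v i; simp [hC, Matrix.mulVec, dotProduct]
  have him : ∀ (v : ι → ℂ) i, ((C *ᵥ v) i).im = (A *ᵥ fun j => (v j).im) i := by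
    intro v i; simp [hC, Matrix.mulVec, dotProduct]
  have hneg : ∀ (z : ℂ) (v : ι → ℂ), v ≠ 0 → C *ᵥ v = z • v → z.re < 0 := by
    intro z v hv h
    by_contra! hz
    obtain ⟨h1, h2⟩ := hA z.re z.im (fun j => (v j).re) (fun j => (v j).im) hz
      (by ext i; rw [← hre, h]; simp)
      (by ext i; rw [← him, h]; simp; ring)
    exact hv (funext fun i => Complex.ext (congrFun h1 i) (congrFun h2 i))
  have hev : ∀ z : ℂ, z ∈ spectrum ℂ C ↔ ∃ v ≠ 0, C *ᵥ v = z • v := by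
    intro z
    rw [← Matrix.spectrum_toLin', ← Module.End.hasEigenvalue_iff_mem_spectrum]
    constructor
    · intro hz
      obtain ⟨v, hv⟩ := hz.exists_hasEigenvector
      exact ⟨v, hv.2, by simpa using hv.apply_eq_smul⟩
    · rintro ⟨v, hv, h⟩
      exact Module.End.hasEigenvalue_of_hasEigenvector (x := v)
        (Module.End.hasEigenvector_iff.2 ⟨Module.End.mem_eigenspace_iff.2 (by simpa using h), hv⟩)
  have hfin : (spectrum ℂ C).Finite := by
    rw [← Matrix.spectrum_toLin']
    exact Module.End.finite_spectrum _
  -- Euler discretisation: `|1 + h z|² = 1 + 2 h Re z + h² |z|²` is below one for small `h > 0`,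
  -- uniformly over the finite spectrum. The powers of `1 + h A` therefore tend to zero.
  obtain ⟨h, hh, hh0⟩ : ∃ h : ℝ, (∀ z ∈ spectrum ℂ C, ‖1 + (h : ℂ) * z‖ < 1) ∧ 0 < h := by
    have : ∀ᶠ h : ℝ in 𝓝[>] 0, ∀ z ∈ spectrum ℂ C, ‖1 + (h : ℂ) * z‖ < 1 := by
      rw [eventually_all_finite hfin]
      intro z hz
      obtain ⟨v, hv, hzv⟩ := (hev z).1 hz
      have hz0 := hneg z v hv hzv
      have ht : Tendsto (fun h : ℝ => h * Complex.normSq z) (𝓝[>] 0) (𝓝 0) := by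
        have : Tendsto (fun h : ℝ => h * Complex.normSq z) (𝓝 0) (𝓝 (0 * Complex.normSq z)) :=
          tendsto_id.mul_const _
        rw [zero_mul] at this
        exact this.mono_left nhdsWithin_le_nhds
      filter_upwards [ht.eventually_lt_const (show 0 < -2 * z.re by linarith),
        self_mem_nhdsWithin] with h h1 h2
      have h2 : 0 < h := h2
      have : ‖1 + (h : ℂ) * z‖ ^ 2 < 1 := by
        rw [Complex.sq_norm]
        rw [Complex.normSq_apply] at h1 ⊢
        simp
        nlinarith
      exact (sq_lt_one_iff₀ (norm_nonneg _)).1 this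
    exact (this.and self_mem_nhdsWithin).exists
  set S : Matrix ι ι ℝ := 1 + h • A with hSdef
  have hSC : S.map Complex.ofReal = 1 + (h : ℂ) • C := by
    ext i j; simp [hSdef, hC, Matrix.one_apply]; split_ifs <;> simp
  have hpow : Tendsto (fun k => (1 + (h : ℂ) • C) ^ k) atTop (𝓝 0) := by
    refine tendsto_pow_zero_of_eigenvalues _ fun z v hv hz => ?_
    have hh' : (h : ℂ) ≠ 0 := by exact_mod_cast hh0.ne'
    have : C *ᵥ v = ((z - 1) / h) • v := by
      rw [Matrix.add_mulVec, Matrix.one_mulVec, Matrix.smul_mulVec] at hz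
      ext i
      have := congrFun hz i
      simp only [Pi.add_apply, Pi.smul_apply, smul_eq_mul] at this ⊢
      field_simp
      linear_combination this
    have := hh _ ((hev _).2 ⟨v, hv, this⟩)
    rwa [mul_div_cancel₀ _ hh', add_sub_cancel] at this
  have hpowR : Tendsto (fun k => S ^ k) atTop (𝓝 0) := by
    have : ∀ k, S ^ k = ((1 + (h : ℂ) • C) ^ k).map Complex.re := by
      intro k
      rw [← hSC]
      have e : (S.map Complex.ofReal) ^ k = (S ^ k).map Complex.ofReal :=
        (map_pow (Complex.ofRealHom.mapMatrix (m := ι)) S k).symm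
      rw [e]; ext i j; simp
    simp_rw [this]
    have hcont : Continuous fun X : Matrix ι ι ℂ => X.map Complex.re :=
      continuous_id.matrix_map Complex.continuous_re
    have := (hcont.tendsto 0).comp hpow
    simpa [Function.comp_def] using this
  have hbound : Tendsto (fun k : ℕ => ∑ i, ∑ j, |((S ^ k)ᵀ * S ^ k : Matrix ι ι ℝ) i j|) atTop
      (𝓝 (0 : ℝ)) := by
    have hcont : Continuous fun X : Matrix ι ι ℝ => ∑ i, ∑ j, |(Xᵀ * X : Matrix ι ι ℝ) i j| := by
      refine continuous_finsetSum _ fun i _ => continuous_finsetSum _ fun j _ => ?_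
      exact ((continuous_id.matrix_transpose.matrix_mul continuous_id).matrix_elem i j).abs
    have := (hcont.tendsto 0).comp hpowR
    simpa [Function.comp_def] using this
  obtain ⟨N, hN, hN1⟩ := ((hbound.eventually_lt_const (show (0 : ℝ) < 1 / 2 by norm_num)).and
    (eventually_ge_atTop 1)).exists
  have hnn : ∀ v : ι → ℝ, 0 ≤ v ⬝ᵥ v := fun v => Finset.sum_nonneg fun i _ => mul_self_nonneg _
  have hT : ∀ (X : Matrix ι ι ℝ) v w, v ⬝ᵥ (Xᵀ * X) *ᵥ w = (X *ᵥ v) ⬝ᵥ (X *ᵥ w) := by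
    intro X v w
    rw [← Matrix.mulVec_mulVec, Matrix.dotProduct_mulVec, Matrix.vecMul_transpose]
  -- The series solving the discrete Lyapunov equation, truncated at an `N` with `|S ^ N v|² ≤ |v|²
  -- / 2`; a finite sum avoids convergence questions.
  set Q : Matrix ι ι ℝ := ∑ k ∈ Finset.range N, (S ^ k)ᵀ * S ^ k with hQ
  have hQv : ∀ v w, v ⬝ᵥ Q *ᵥ w = ∑ k ∈ Finset.range N, ((S ^ k) *ᵥ v) ⬝ᵥ ((S ^ k) *ᵥ w) := by
    intro v w
    rw [hQ, Matrix.sum_mulVec, dotProduct_sum]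
    exact Finset.sum_congr rfl fun k _ => hT _ _ _
  have hQsymm : Q.IsSymm := by
    rw [Matrix.IsSymm, hQ, Matrix.transpose_sum]
    simp [Matrix.transpose_mul]
  have hQcomm : ∀ v w, v ⬝ᵥ Q *ᵥ w = w ⬝ᵥ Q *ᵥ v := by
    intro v w; rw [hQv, hQv]; exact Finset.sum_congr rfl fun k _ => dotProduct_comm _ _
  have hQnn : ∀ v, 0 ≤ v ⬝ᵥ Q *ᵥ v := fun v => by
    rw [hQv]; exact Finset.sum_nonneg fun k _ => hnn _
  have hQge : ∀ v, v ⬝ᵥ v ≤ v ⬝ᵥ Q *ᵥ v := by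
    intro v
    rw [hQv]
    have := Finset.single_le_sum (f := fun k => ((S ^ k) *ᵥ v) ⬝ᵥ ((S ^ k) *ᵥ v))
      (fun k _ => hnn _) (Finset.mem_range.2 hN1)
    simpa using this
  -- Replacing `v` by `S v` shifts the sum by one index, so the change telescopes to `|S ^ N v|² -
  -- |v|²`.
  have hdec : ∀ v, (S *ᵥ v) ⬝ᵥ Q *ᵥ (S *ᵥ v) ≤ v ⬝ᵥ Q *ᵥ v - 1 / 2 * (v ⬝ᵥ v) := by
    intro v
    have h1 := dotProduct_mulVec_le ((S ^ N)ᵀ * S ^ N) v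
    rw [hT] at h1
    have h2 := mul_le_mul_of_nonneg_right hN.le (hnn v)
    have h3 := Finset.sum_range_succ (fun k => ((S ^ k) *ᵥ v) ⬝ᵥ ((S ^ k) *ᵥ v)) N
    rw [Finset.sum_range_succ'] at h3
    rw [hQv, hQv]
    simp only [Matrix.mulVec_mulVec, ← pow_succ]
    simp only [pow_zero, Matrix.one_mulVec] at h3
    linarith
  set K := ∑ i, ∑ j, |Q i j|
  have hK : 0 ≤ K := Finset.sum_nonneg fun i _ => Finset.sum_nonneg fun j _ => abs_nonneg _
  -- Expanding `S v = v + h A v` in `hdec` and dropping the square of `A v` gives `2 h vᵀQAv ≤ -|v|²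
  -- / 2`; then `vᵀQv ≤ (K + 1) |v|²` yields this constant.
  refine ⟨Q, hQsymm, hQge, 1 / (4 * h * (K + 1)), by positivity, fun v => ?_⟩
  have h1 := hdec v
  have h2 : S *ᵥ v = v + h • (A *ᵥ v) := by
    rw [hSdef, Matrix.add_mulVec, Matrix.one_mulVec, Matrix.smul_mulVec]
  rw [h2] at h1
  simp only [Matrix.mulVec_add, Matrix.mulVec_smul, dotProduct_add, add_dotProduct, smul_dotProduct,
    dotProduct_smul, smul_eq_mul] at h1
  rw [hQcomm (A *ᵥ v) v] at h1
  have h3 := mul_nonneg (mul_nonneg hh0.le hh0.le) (hQnn (A *ᵥ v))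
  have h4 : v ⬝ᵥ Q *ᵥ v ≤ (K + 1) * (v ⬝ᵥ v) :=
    (dotProduct_mulVec_le Q v).trans (by nlinarith [hnn v])
  rw [neg_mul, le_neg, div_mul_eq_mul_div, one_mul, div_le_iff₀ (by positivity)]
  nlinarith

end Lyapunov

/-! ### Maximum principle on a digraph. -/

/-- A function on the vertices whose value at each vertex is a weighted mean over the in-neighbors
is constant on a digraph with a spanning tree. -/
theorem eq_root_of_harmonic {V : Type*} [Fintype V] {T : Digraph V} {r : V}
    (hT : ∀ v, Relation.ReflTransGen T.Adj r v) {g : V → V → ℝ} (hg : ∀ i j, 0 ≤ g i j)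
    (hpos : ∀ i j, T.Adj j i → 0 < g i j) {f : V → ℝ}
    (hf : ∀ i, ∑ j, g i j * (f j - f i) = 0) (i : V) : f i = f r := by
  have main : ∀ f : V → ℝ, (∀ i, ∑ j, g i j * (f j - f i) = 0) → ∀ i, f i ≤ f r := by
    intro f hf
    obtain ⟨m, -, hm⟩ := Finset.exists_max_image Finset.univ f ⟨r, Finset.mem_univ r⟩
    have hm : ∀ j, f j ≤ f m := fun j => hm j (Finset.mem_univ j)
    -- At a maximum every term of the weighted sum is nonpositive, so each vanishes and in-neighbors
    -- joined by positive weight attain the maximum too. Maximality thus travels backwards along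
    -- arcs, up to the root.
    have step : ∀ a b, T.Adj a b → f b = f m → f a = f m := by
      intro a b hab hb
      have hterm : ∀ j ∈ Finset.univ, g b j * (f j - f b) ≤ 0 := fun j _ =>
        mul_nonpos_of_nonneg_of_nonpos (hg b j) (by rw [hb]; linarith [hm j])
      have := (Finset.sum_eq_zero_iff_of_nonpos hterm).1 (hf b) a (Finset.mem_univ a)
      rcases mul_eq_zero.1 this with h | h
      · exact absurd h (hpos b a hab).ne'
      · linarith
    have hr : f r = f m := by
      have : ∀ a, Relation.ReflTransGen T.Adj a m → f a = f m := by
        intro a ha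
        induction ha using Relation.ReflTransGen.head_induction_on with
        | refl => rfl
        | head hab _ ih => exact step _ _ hab ih
      exact this r (hT m)
    intro i
    rw [hr]
    exact hm i
  refine le_antisymm (main f hf i) ?_
  -- The same principle for `-f` makes the root a minimum as well.
  have := main (fun i => - f i) (fun i => by
    rw [← neg_eq_zero, ← Finset.sum_neg_distrib, ← hf i]
    exact Finset.sum_congr rfl fun j _ => by ring) i
  linarith

/-! ### Kernel, range and spectrum of the mean matrix. -/

section Structure

variable {n : ℕ}

theorem sum_Gam_mul (g : Fin n → Fin n → ℝ) (f : Fin n → ℝ) (i : Fin n) :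
    ∑ j, Gam g i j * f j = ∑ j, g i j * (f j - f i) := by
  rw [← Finset.add_sum_erase _ _ (Finset.mem_univ i),
    ← Finset.add_sum_erase _ (fun j => g i j * (f j - f i)) (Finset.mem_univ i)]
  have : ∀ j ∈ Finset.univ.erase i, Gam g i j * f j = g i j * f j := fun j hj => by
    simp [Gam, (Finset.ne_of_mem_erase hj).symm]
  rw [Finset.sum_congr rfl this]
  simp only [Gam, Matrix.of_apply, if_true, sub_self, mul_zero, zero_add, mul_sub,
    Finset.sum_sub_distrib, neg_mul, Finset.sum_mul]
  ring

theorem blockDiag_kronecker_apply (M : Fin n → Matrix (Fin 2) (Fin 2) ℝ)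
    (g : Fin n → Fin n → ℝ) (q r : Fin n × Fin 2) :
    (blockDiag M * (Gam g ⊗ₖ (1 : Matrix (Fin 2) (Fin 2) ℝ))) q r =
      M q.1 q.2 r.2 * Gam g q.1 r.1 := by
  rw [Matrix.mul_apply, Fintype.sum_prod_type]
  simp [blockDiag, Matrix.one_apply]

theorem blockDiag_kronecker_mulVec (M : Fin n → Matrix (Fin 2) (Fin 2) ℝ)
    (g : Fin n → Fin n → ℝ) (v : Fin n × Fin 2 → ℝ) (i : Fin n) (k : Fin 2) :
    ((blockDiag M * (Gam g ⊗ₖ (1 : Matrix (Fin 2) (Fin 2) ℝ))) *ᵥ v) (i, k) =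
      ∑ l, M i k l * ∑ j, g i j * (v (j, l) - v (i, l)) := by
  simp only [← fun l => sum_Gam_mul g (fun j => v (j, l)) i]
  rw [Matrix.mulVec, dotProduct, Fintype.sum_prod_type_right]
  simp only [blockDiag_kronecker_apply, Finset.mul_sum, mul_assoc]

theorem blockDiag_kronecker_mulVec_iVec (M : Fin n → Matrix (Fin 2) (Fin 2) ℝ)
    (g : Fin n → Fin n → ℝ) (k : Fin 2) :
    (blockDiag M * (Gam g ⊗ₖ (1 : Matrix (Fin 2) (Fin 2) ℝ))) *ᵥ iVec n k = 0 := by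
  ext ⟨i, l⟩
  rw [blockDiag_kronecker_mulVec]
  simp [iVec]

/-- The bilinear form of the second moment matrix of `(x, 1)`. -/
def momentForm (m s2 : ℝ) (x y : Fin 2 → ℝ) : ℝ :=
  s2 * (x 0 * y 0) + m * (x 0 * y 1 + x 1 * y 0) + x 1 * y 1

/-- The bilinear form `α² xᵀ A⁻¹ y`, where `A` is the symmetric positive definite factor of the
mean of `Φ`. -/
def gainForm (α β : ℝ) (x y : Fin 2 → ℝ) : ℝ :=
  x 0 * y 0 + (β * x 0 - α * x 1) * (β * y 0 - α * y 1)

theorem gainForm_self_nonneg (α β : ℝ) (x : Fin 2 → ℝ) : 0 ≤ gainForm α β x x := by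
  exact add_nonneg (mul_self_nonneg _) (mul_self_nonneg _)

theorem eq_zero_of_gainForm_self {α : ℝ} (hα : α ≠ 0) (β : ℝ) {x : Fin 2 → ℝ}
    (h : gainForm α β x x ≤ 0) : x = 0 := by
  unfold gainForm at h
  have h0 : x 0 = 0 := by nlinarith [mul_self_nonneg (x 0), mul_self_nonneg (β * x 0 - α * x 1)]
  have h1 : α * x 1 = 0 := by rw [h0] at h; nlinarith [mul_self_nonneg (α * x 1)]
  ext k
  fin_cases k
  · exact h0
  · exact (mul_eq_zero.1 h1).resolve_left hα

theorem momentForm_self_nonneg {m s2 : ℝ} (h : 0 < s2 - m ^ 2) (x : Fin 2 → ℝ) :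
    0 ≤ momentForm m s2 x x := by
  unfold momentForm
  nlinarith [sq_nonneg (m * x 0 + x 1), mul_nonneg h.le (sq_nonneg (x 0))]

theorem eq_zero_of_momentForm_self {m s2 : ℝ} (h : 0 < s2 - m ^ 2) {x : Fin 2 → ℝ}
    (hx : momentForm m s2 x x ≤ 0) : x = 0 := by
  have e : momentForm m s2 x x = (m * x 0 + x 1) ^ 2 + (s2 - m ^ 2) * x 0 ^ 2 := by
    unfold momentForm; ring
  rw [e] at hx
  have h0 : x 0 = 0 := by
    have : (s2 - m ^ 2) * x 0 ^ 2 ≤ 0 := by nlinarith [sq_nonneg (m * x 0 + x 1)]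
    have := nonpos_of_mul_nonpos_right this h
    exact pow_eq_zero_iff (two_ne_zero) |>.1 (le_antisymm this (sq_nonneg _))
  have h1 : x 1 = 0 := by rw [h0] at hx; nlinarith
  ext k
  fin_cases k
  exacts [h0, h1]

/-- The mean of `Φ` factors as `A M` with `A = [[α², αβ], [αβ, 1 + β²]]`, of determinant `α²`, and
`M = [[s2, m], [m, 1]]`. Multiplying by `α² A⁻¹` cancels the node-dependent factor and leaves `M`,
which is common to all nodes. -/
theorem gainForm_PhiBar (α β m s2 : ℝ) (c s : Fin 2 → ℝ) :
    gainForm α β c (fun k => ∑ l, PhiBar α β m s2 k l * s l) = α ^ 2 * momentForm m s2 c s := by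
  simp [gainForm, momentForm, PhiBar, Fin.sum_univ_two]
  ring

theorem momentForm_sum {ι : Type*} (m s2 : ℝ) (c : Fin 2 → ℝ) (t : Finset ι) (g : ι → ℝ)
    (v : ι → Fin 2 → ℝ) :
    momentForm m s2 c (fun l => ∑ j ∈ t, g j * v j l) = ∑ j ∈ t, g j * momentForm m s2 c (v j) := by
  simp only [momentForm, Finset.mul_sum, ← Finset.sum_add_distrib]
  exact Finset.sum_congr rfl fun j _ => by ring

variable {α β : Fin n → ℝ} {γ p : Fin n → Fin n → ℝ} {m s2 : ℝ}

/-- Block row `i` of `B̄' v = u`, tested against a vector `c`. -/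
theorem gainForm_BbarMat_mulVec (v : Fin n × Fin 2 → ℝ) (i : Fin n) (c : Fin 2 → ℝ) :
    gainForm (α i) (β i) c (fun k => (BbarMat α β γ p m s2 *ᵥ v) (i, k)) =
      α i ^ 2 * ∑ j, γ i j * p i j * momentForm m s2 c (fun l => v (j, l) - v (i, l)) := by
  rw [← momentForm_sum, ← gainForm_PhiBar _ (β i)]
  simp only [BbarMat, blockDiag_kronecker_mulVec]

theorem BbarMat_mulVec_iVec (k : Fin 2) : BbarMat α β γ p m s2 *ᵥ iVec n k = 0 :=
  blockDiag_kronecker_mulVec_iVec _ _ k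

theorem Bmat_mulVec_iVec (g : Fin n → Fin n → ℝ) (x : ℝ) (k : Fin 2) :
    Bmat α β g x *ᵥ iVec n k = 0 :=
  blockDiag_kronecker_mulVec_iVec _ _ k

theorem linearIndependent_iVec [NeZero n] : LinearIndependent ℝ (iVec n) := by
  rw [Fintype.linearIndependent_iff]
  intro c hc k
  have := congrFun hc (0, k)
  simpa [iVec] using this

/-- Testing a vanishing block row against the Laplacian term itself and using definiteness of `M`
shows that this term is zero; each coordinate is then harmonic on the digraph, hence constant. -/
theorem ker_BbarMat (hα : ∀ i, α i ≠ 0) (hvar : 0 < s2 - m ^ 2) {T : Digraph (Fin n)} {r : Fin n}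
    (hT : ∀ v, Relation.ReflTransGen T.Adj r v) (hg : ∀ i j, 0 ≤ γ i j * p i j)
    (hpos : ∀ i j, T.Adj j i → 0 < γ i j * p i j) :
    LinearMap.ker (BbarMat α β γ p m s2).mulVecLin = Submodule.span ℝ (Set.range (iVec n)) := by
  apply le_antisymm
  · intro v hv
    have hv : BbarMat α β γ p m s2 *ᵥ v = 0 := hv
    have hs : ∀ i, (fun l => ∑ j, γ i j * p i j * (v (j, l) - v (i, l))) = (0 : Fin 2 → ℝ) := by
      intro i
      refine eq_zero_of_momentForm_self hvar (le_of_eq ?_)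
      have := gainForm_BbarMat_mulVec (α := α) (β := β) (γ := γ) (p := p) (m := m) (s2 := s2) v i
        (fun l => ∑ j, γ i j * p i j * (v (j, l) - v (i, l)))
      rw [hv, ← momentForm_sum] at this
      have h0 := pow_ne_zero 2 (hα i)
      refine (mul_eq_zero.1 (this.symm.trans ?_)).resolve_left h0
      simp [gainForm]
    have hc : ∀ i l, v (i, l) = v (r, l) := fun i l =>
      eq_root_of_harmonic hT hg hpos (f := fun i => v (i, l)) (fun i => congrFun (hs i) l) i
    have : v = ∑ k, v (r, k) • iVec n k := by
      ext ⟨i, l⟩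
      rw [hc i l]
      simp [iVec]
    rw [this]
    exact Submodule.sum_mem _ fun k _ =>
      Submodule.smul_mem _ _ (Submodule.subset_span ⟨k, rfl⟩)
  · rw [Submodule.span_le]
    rintro _ ⟨k, rfl⟩
    exact BbarMat_mulVec_iVec k

/-- This makes the eigenvalue zero semisimple. If every block of `B̄' v` equals `c`, consider the
block `i` where the `M`-product of `c` with `v i` is largest: the Laplacian term tested against `c`
is nonpositive there, while it equals the form of `A⁻¹` at `c` up to a positive factor. So `c = 0`.
-/
theorem disjoint_range_iVec [NeZero n] (hα : ∀ i, α i ≠ 0) (hg : ∀ i j, 0 ≤ γ i j * p i j) :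
    Disjoint (LinearMap.range (BbarMat α β γ p m s2).mulVecLin)
      (Submodule.span ℝ (Set.range (iVec n))) := by
  rw [Submodule.disjoint_def]
  rintro _ ⟨v, rfl⟩ hu
  obtain ⟨c, hc⟩ := (Submodule.mem_span_range_iff_exists_fun ℝ).1 hu
  have hv : ∀ i k, (BbarMat α β γ p m s2 *ᵥ v) (i, k) = c k := by
    intro i k
    have := congrFun hc (i, k)
    simp only [Matrix.mulVecLin_apply] at this
    rw [← this]
    simp [iVec]
  obtain ⟨i, -, hi⟩ := Finset.exists_max_image Finset.univ
    (fun i => momentForm m s2 c (fun l => v (i, l))) ⟨0, Finset.mem_univ 0⟩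
  have h1 := gainForm_BbarMat_mulVec (α := α) (β := β) (γ := γ) (p := p) (m := m) (s2 := s2) v i c
  simp only [hv] at h1
  have hsum : ∑ j, γ i j * p i j * momentForm m s2 c (fun l => v (j, l) - v (i, l)) ≤ 0 := by
    refine Finset.sum_nonpos fun j _ => mul_nonpos_of_nonneg_of_nonpos (hg i j) ?_
    have := hi j (Finset.mem_univ j)
    simp only [momentForm] at this ⊢
    linarith
  have hc0 : c = 0 := eq_zero_of_gainForm_self (hα i) (β i)
    (h1.le.trans (mul_nonpos_of_nonneg_of_nonpos (sq_nonneg _) hsum))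
  rw [← hc, hc0]
  simp

/-- `B̄'` has no nonzero eigenvalue with nonnegative real part. -/
theorem eq_zero_of_BbarMat_eigen [NeZero n] (hα : ∀ i, α i ≠ 0) (hvar : 0 < s2 - m ^ 2)
    (hg : ∀ i j, 0 ≤ γ i j * p i j) {σ τ : ℝ} (hσ : 0 ≤ σ) (hne : σ ^ 2 + τ ^ 2 ≠ 0)
    {a b : Fin n × Fin 2 → ℝ} (ha : BbarMat α β γ p m s2 *ᵥ a = σ • a - τ • b)
    (hb : BbarMat α β γ p m s2 *ᵥ b = τ • a + σ • b) : a = 0 ∧ b = 0 := by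
  set N : (Fin n × Fin 2 → ℝ) → Fin n → ℝ :=
    fun v i => momentForm m s2 (fun l => v (i, l)) (fun l => v (i, l)) with hN
  -- The node at which the `M`-norm of the complex eigenvector `a + i b` is largest.
  obtain ⟨i, -, hi⟩ := Finset.exists_max_image Finset.univ
    (fun i => N a i + N b i) ⟨0, Finset.mem_univ 0⟩
  have hi : ∀ j, N a j + N b j ≤ N a i + N b i := fun j => hi j (Finset.mem_univ j)
  set D : (Fin n × Fin 2 → ℝ) → Fin n → ℝ := fun v j =>
    momentForm m s2 (fun l => v (j, l) - v (i, l)) (fun l => v (j, l) - v (i, l)) with hD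
  have hD0 : ∀ v j, 0 ≤ D v j := fun v j => momentForm_self_nonneg hvar _
  have hN0 : ∀ v j, 0 ≤ N v j := fun v j => momentForm_self_nonneg hvar _
  -- Polarization compares neighboring norms: `⟨v i, v j - v i⟩` is half of `|v j|² - |v i|² - |v j
  -- - v i|²`.
  have polar : ∀ v j, momentForm m s2 (fun l => v (i, l)) (fun l => v (j, l) - v (i, l)) =
      (N v j - N v i - D v j) / 2 := by
    intro v j
    simp only [hN, hD, momentForm]
    ring
  have h1 := gainForm_BbarMat_mulVec (α := α) (β := β) (γ := γ) (p := p) (m := m) (s2 := s2)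
    a i (fun l => a (i, l))
  have h2 := gainForm_BbarMat_mulVec (α := α) (β := β) (γ := γ) (p := p) (m := m) (s2 := s2)
    b i (fun l => b (i, l))
  rw [ha] at h1
  rw [hb] at h2
  simp only [polar] at h1 h2
  have hlhs : gainForm (α i) (β i) (fun l => a (i, l)) (fun k => (σ • a - τ • b) (i, k)) +
      gainForm (α i) (β i) (fun l => b (i, l)) (fun k => (τ • a + σ • b) (i, k)) =
      σ * (gainForm (α i) (β i) (fun l => a (i, l)) (fun l => a (i, l)) +
        gainForm (α i) (β i) (fun l => b (i, l)) (fun l => b (i, l))) := by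
    simp only [gainForm, Pi.sub_apply, Pi.add_apply, Pi.smul_apply, smul_eq_mul]
    ring
  have hnn : 0 ≤ α i ^ 2 * ∑ j, γ i j * p i j *
      ((N a j - N a i - D a j) / 2 + (N b j - N b i - D b j) / 2) := by
    simp only [mul_add, Finset.sum_add_distrib]
    rw [← h1, ← h2, hlhs]
    exact mul_nonneg hσ (add_nonneg (gainForm_self_nonneg _ _ _) (gainForm_self_nonneg _ _ _))
  have hterm : ∀ j ∈ Finset.univ, γ i j * p i j *
      ((N a j - N a i - D a j) / 2 + (N b j - N b i - D b j) / 2) ≤ 0 := fun j _ =>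
    mul_nonpos_of_nonneg_of_nonpos (hg i j) (by linarith [hi j, hD0 a j, hD0 b j])
  -- The sum is nonnegative because `σ ≥ 0` and nonpositive by maximality, so every term vanishes. A
  -- neighbor of positive weight then agrees with node `i`, and block row `i` of `B̄'` gives zero.
  -- As the eigenvalue is nonzero, the largest block itself is zero.
  have hzero := (Finset.sum_eq_zero_iff_of_nonpos hterm).1 (le_antisymm
    (Finset.sum_nonpos hterm) (nonneg_of_mul_nonneg_right hnn (by have := hα i; positivity)))
  have hrow : ∀ v, (v = a ∨ v = b) → ∀ k, (BbarMat α β γ p m s2 *ᵥ v) (i, k) = 0 := by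
    intro v hv k
    rw [BbarMat, blockDiag_kronecker_mulVec]
    refine Finset.sum_eq_zero fun l _ => mul_eq_zero_of_right _ (Finset.sum_eq_zero fun j hj => ?_)
    rcases mul_eq_zero.1 (hzero j hj) with h | h
    · rw [h, zero_mul]
    · have hDv : D v j ≤ 0 := by
        rcases hv with rfl | rfl
        · linarith [hi j, hD0 v j, hD0 b j]
        · linarith [hi j, hD0 a j, hD0 v j]
      have := congrFun (eq_zero_of_momentForm_self hvar hDv) l
      simp only [Pi.zero_apply] at this
      rw [this, mul_zero]
  have hai : ∀ k, a (i, k) = 0 ∧ b (i, k) = 0 := by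
    intro k
    have e1 := hrow a (Or.inl rfl) k
    have e2 := hrow b (Or.inr rfl) k
    rw [ha] at e1
    rw [hb] at e2
    simp only [Pi.sub_apply, Pi.add_apply, Pi.smul_apply, smul_eq_mul] at e1 e2
    constructor
    · exact (mul_eq_zero.1 (show (σ ^ 2 + τ ^ 2) * a (i, k) = 0 by
        linear_combination σ * e1 + τ * e2)).resolve_left hne
    · exact (mul_eq_zero.1 (show (σ ^ 2 + τ ^ 2) * b (i, k) = 0 by
        linear_combination σ * e2 - τ * e1)).resolve_left hne
  have hNi : N a i + N b i = 0 := by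
    simp [hN, momentForm, hai]
  have hall : ∀ v, (v = a ∨ v = b) → v = 0 := by
    intro v hv
    ext ⟨j, l⟩
    have hv0 : N v j ≤ 0 := by
      rcases hv with rfl | rfl
      · linarith [hi j, hN0 b j]
      · linarith [hi j, hN0 a j]
    exact congrFun (eq_zero_of_momentForm_self hvar hv0) l
  exact ⟨hall a (Or.inl rfl), hall b (Or.inr rfl)⟩

end Structure

/-! ### The splitting at eigenvalue zero and the consensus projection. -/

section Structure

variable {n : ℕ} {α β : Fin n → ℝ} {γ p : Fin n → Fin n → ℝ} {m s2 : ℝ}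

theorem transMat_col_inl (T₀ : Matrix (Fin n × Fin 2) (Fin (2 * n - 2)) ℝ) (k : Fin 2) :
    (transMat T₀).col (Sum.inl k) = iVec n k := rfl

theorem transMat_col_inr (T₀ : Matrix (Fin n × Fin 2) (Fin (2 * n - 2)) ℝ)
    (j : Fin (2 * n - 2)) : (transMat T₀).col (Sum.inr j) = T₀.col j := rfl

/-- Annihilating a matrix from the left depends only on its column space, so `T₀` and `B̄'` can be
exchanged. -/
theorem vecMul_eq_zero_iff_col {ι κ : Type*} [Fintype ι] (M : Matrix ι κ ℝ) (v : ι → ℝ) :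
    v ᵥ* M = 0 ↔ ∀ w ∈ Submodule.span ℝ (Set.range M.col), v ⬝ᵥ w = 0 := by
  constructor
  · intro h w hw
    induction hw using Submodule.span_induction with
    | mem x hx => obtain ⟨j, rfl⟩ := hx; exact congrFun h j
    | zero => simp
    | add x y _ _ hx hy => rw [dotProduct_add, hx, hy, add_zero]
    | smul c x _ hx => rw [dotProduct_smul, hx, smul_zero]
  · intro h
    ext j
    exact h _ (Submodule.subset_span ⟨j, rfl⟩)

/-- Spectral structure of `B̄'` at the eigenvalue zero: matrices `T₀` with the column space of `B̄'`
exist, each `[i₁ i₂ T₀]` is invertible, and the first two rows of the inverse do not depend on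
`T₀`. -/
theorem exists_left_eigenvectors [NeZero n] (hα : ∀ i, α i ≠ 0) (hvar : 0 < s2 - m ^ 2)
    {T : Digraph (Fin n)} {r : Fin n} (hT : ∀ v, Relation.ReflTransGen T.Adj r v)
    (hg : ∀ i j, 0 ≤ γ i j * p i j) (hpos : ∀ i j, T.Adj j i → 0 < γ i j * p i j) :
    ∃ π : Fin 2 → Fin n × Fin 2 → ℝ, (∀ k, π k ᵥ* BbarMat α β γ p m s2 = 0) ∧
      (∀ k l, π k ⬝ᵥ iVec n l = if k = l then 1 else 0) ∧
      (∃ T₀ : Matrix (Fin n × Fin 2) (Fin (2 * n - 2)) ℝ,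
        Submodule.span ℝ (Set.range T₀.col) =
          Submodule.span ℝ (Set.range (BbarMat α β γ p m s2).col)) ∧
      ∀ T₀ : Matrix (Fin n × Fin 2) (Fin (2 * n - 2)) ℝ,
        Submodule.span ℝ (Set.range T₀.col) =
          Submodule.span ℝ (Set.range (BbarMat α β γ p m s2).col) →
        ∃ S : Matrix (Fin 2 ⊕ Fin (2 * n - 2)) (Fin n × Fin 2) ℝ,
          S * transMat T₀ = 1 ∧ transMat T₀ * S = 1 ∧ ∀ k, S.row (Sum.inl k) = π k := by
  set B := BbarMat α β γ p m s2 with hB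
  have hker := ker_BbarMat (α := α) (β := β) hα hvar hT hg hpos
  have hdisj := disjoint_range_iVec (α := α) (β := β) (m := m) (s2 := s2) hα hg
  have hkerdim : Module.finrank ℝ (LinearMap.ker B.mulVecLin) = 2 := by
    rw [hker, finrank_span_eq_card linearIndependent_iVec, Fintype.card_fin]
  have hsum := LinearMap.finrank_range_add_finrank_ker B.mulVecLin
  have hrange : Module.finrank ℝ (LinearMap.range B.mulVecLin) = 2 * n - 2 := by
    rw [hkerdim, Module.finrank_fintype_fun_eq_card, Fintype.card_prod, Fintype.card_fin,
      Fintype.card_fin] at hsum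
    omega
  have htop : LinearMap.range B.mulVecLin ⊔ Submodule.span ℝ (Set.range (iVec n)) = ⊤ := by
    rw [← hker] at hdisj ⊢
    exact Submodule.eq_top_of_disjoint _ _ hsum.ge hdisj
  have hex : ∃ T₀ : Matrix (Fin n × Fin 2) (Fin (2 * n - 2)) ℝ,
      Submodule.span ℝ (Set.range T₀.col) = Submodule.span ℝ (Set.range B.col) := by
    let b := Module.finBasisOfFinrankEq ℝ (LinearMap.range B.mulVecLin) hrange
    refine ⟨Matrix.of fun q j => (b j : Fin n × Fin 2 → ℝ) q, ?_⟩
    rw [← Matrix.range_mulVecLin B]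
    have h1 : Set.range (Matrix.of fun q j => (b j : Fin n × Fin 2 → ℝ) q).col =
        (LinearMap.range B.mulVecLin).subtype '' Set.range b := by
      rw [← Set.range_comp]
      rfl
    rw [h1, Submodule.span_image, b.span_eq, Submodule.map_top, Submodule.range_subtype]
  have hS : ∀ T₀ : Matrix (Fin n × Fin 2) (Fin (2 * n - 2)) ℝ,
      Submodule.span ℝ (Set.range T₀.col) = Submodule.span ℝ (Set.range B.col) →
      ∃ S : Matrix (Fin 2 ⊕ Fin (2 * n - 2)) (Fin n × Fin 2) ℝ,
        S * transMat T₀ = 1 ∧ transMat T₀ * S = 1 := by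
    intro T₀ hT₀
    have hsurj : Function.Surjective (transMat T₀).mulVec := by
      have : LinearMap.range (transMat T₀).mulVecLin = ⊤ := by
        rw [Matrix.range_mulVecLin, eq_top_iff, ← htop, Matrix.range_mulVecLin, ← hT₀, sup_le_iff]
        constructor <;> refine Submodule.span_mono ?_
        · rintro _ ⟨j, rfl⟩
          exact ⟨Sum.inr j, transMat_col_inr T₀ j⟩
        · rintro _ ⟨k, rfl⟩
          exact ⟨Sum.inl k, transMat_col_inl T₀ k⟩
      exact LinearMap.range_eq_top.1 this
    obtain ⟨S, hS⟩ := Matrix.mulVec_surjective_iff_exists_right_inverse.1 hsurj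
    have hn : 1 ≤ n := NeZero.one_le
    have e : Fin n × Fin 2 ≃ Fin 2 ⊕ Fin (2 * n - 2) :=
      Fintype.equivOfCardEq (by simp; omega)
    exact ⟨S, (Matrix.mul_eq_one_comm_of_equiv e).1 hS, hS⟩
  obtain ⟨T₁, hT₁⟩ := hex
  obtain ⟨S₁, hS₁, -⟩ := hS T₁ hT₁
  have hrow : ∀ (k : Fin 2) (c : Fin 2 ⊕ Fin (2 * n - 2)),
      S₁.row (Sum.inl k) ⬝ᵥ (transMat T₁).col c =
      (1 : Matrix (Fin 2 ⊕ Fin (2 * n - 2)) (Fin 2 ⊕ Fin (2 * n - 2)) ℝ) (Sum.inl k) c := by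
    intro k c
    rw [← hS₁]
    rfl
  have hdual : ∀ k l, S₁.row (Sum.inl k) ⬝ᵥ iVec n l = if k = l then 1 else 0 := by
    intro k l
    have := hrow k (Sum.inl l)
    rw [transMat_col_inl] at this
    rw [this, Matrix.one_apply]
    simp
  have hkill : ∀ k, S₁.row (Sum.inl k) ᵥ* B = 0 := by
    intro k
    rw [vecMul_eq_zero_iff_col, ← hT₁, ← vecMul_eq_zero_iff_col]
    ext j
    have := hrow k (Sum.inr j)
    rw [transMat_col_inr] at this
    exact this.trans (by simp)
  refine ⟨fun k => S₁.row (Sum.inl k), hkill, hdual, ⟨T₁, hT₁⟩, fun T₀ hT₀ => ?_⟩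
  obtain ⟨S, h1, h2⟩ := hS T₀ hT₀
  refine ⟨S, h1, h2, fun k => ?_⟩
  -- The rows obtained from the particular `T₁` are dual to `i₁, i₂` and annihilate the range of
  -- `B̄'`. These conditions do not mention `T₁`, and they determine the first two rows of the
  -- inverse for any `T₀`.
  have hk : S₁.row (Sum.inl k) ᵥ* transMat T₀ = Pi.single (Sum.inl k) 1 := by
    ext c
    rcases c with l | j
    · change S₁.row (Sum.inl k) ⬝ᵥ iVec n l = _
      rw [hdual]
      simp [Pi.single_apply, eq_comm]
    · have := hkill k
      rw [vecMul_eq_zero_iff_col, ← hT₀, ← vecMul_eq_zero_iff_col] at this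
      exact (congrFun this j).trans (by simp)
  have : S₁.row (Sum.inl k) = (S₁.row (Sum.inl k) ᵥ* transMat T₀) ᵥ* S := by
    rw [Matrix.vecMul_vecMul, h2, Matrix.vecMul_one]
  change S.row (Sum.inl k) = S₁.row (Sum.inl k)
  rw [this, hk, Matrix.single_one_vecMul]

/-- The projection onto `span (i₁, i₂)` along the kernel of the functionals `π k`. -/
def consensusProj (π : Fin 2 → Fin n × Fin 2 → ℝ) : Matrix (Fin n × Fin 2) (Fin n × Fin 2) ℝ :=
  ∑ k, Matrix.vecMulVec (iVec n k) (π k)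

theorem consensusProj_mulVec (π : Fin 2 → Fin n × Fin 2 → ℝ) (v : Fin n × Fin 2 → ℝ) :
    consensusProj π *ᵥ v = ∑ k, (π k ⬝ᵥ v) • iVec n k := by
  rw [consensusProj, Matrix.sum_mulVec]
  refine Finset.sum_congr rfl fun k _ => ?_
  rw [Matrix.vecMulVec_mulVec]
  ext
  simp [mul_comm]

theorem mul_consensusProj {M : Matrix (Fin n × Fin 2) (Fin n × Fin 2) ℝ}
    (hM : ∀ k, M *ᵥ iVec n k = 0) (π : Fin 2 → Fin n × Fin 2 → ℝ) : M * consensusProj π = 0 := by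
  rw [consensusProj, Finset.mul_sum]
  refine Finset.sum_eq_zero fun k _ => ?_
  rw [Matrix.mul_vecMulVec, hM, Matrix.zero_vecMulVec]

theorem consensusProj_mul {M : Matrix (Fin n × Fin 2) (Fin n × Fin 2) ℝ}
    {π : Fin 2 → Fin n × Fin 2 → ℝ} (hM : ∀ k, π k ᵥ* M = 0) : consensusProj π * M = 0 := by
  rw [consensusProj, Finset.sum_mul]
  refine Finset.sum_eq_zero fun k _ => ?_
  rw [Matrix.vecMulVec_mul, hM, Matrix.vecMulVec_zero]

theorem consensusProj_mul_self {π : Fin 2 → Fin n × Fin 2 → ℝ}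
    (hπ : ∀ k l, π k ⬝ᵥ iVec n l = if k = l then 1 else 0) :
    consensusProj π * consensusProj π = consensusProj π := by
  refine Matrix.ext_iff_mulVec.2 fun v => ?_
  rw [← Matrix.mulVec_mulVec]
  simp only [consensusProj_mulVec, dotProduct_sum, dotProduct_smul, hπ, smul_eq_mul, mul_ite,
    mul_one, mul_zero, Finset.sum_ite_eq, Finset.mem_univ, if_true]

/-- `B̄' - Π` has no eigenvalue with nonnegative real part. -/
theorem eq_zero_of_deflated_eigen [NeZero n] (hα : ∀ i, α i ≠ 0) (hvar : 0 < s2 - m ^ 2)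
    {T : Digraph (Fin n)} {r : Fin n} (hT : ∀ v, Relation.ReflTransGen T.Adj r v)
    (hg : ∀ i j, 0 ≤ γ i j * p i j) (hpos : ∀ i j, T.Adj j i → 0 < γ i j * p i j)
    {π : Fin 2 → Fin n × Fin 2 → ℝ} (hkill : ∀ k, π k ᵥ* BbarMat α β γ p m s2 = 0)
    (hπ : ∀ k l, π k ⬝ᵥ iVec n l = if k = l then 1 else 0) (σ τ : ℝ) (a b : Fin n × Fin 2 → ℝ)
    (hσ : 0 ≤ σ) (ha : (BbarMat α β γ p m s2 - consensusProj π) *ᵥ a = σ • a - τ • b)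
    (hb : (BbarMat α β γ p m s2 - consensusProj π) *ᵥ b = τ • a + σ • b) : a = 0 ∧ b = 0 := by
  have hdot : ∀ k v, π k ⬝ᵥ (BbarMat α β γ p m s2 - consensusProj π) *ᵥ v = - (π k ⬝ᵥ v) := by
    intro k v
    rw [Matrix.sub_mulVec, dotProduct_sub, Matrix.dotProduct_mulVec, hkill, zero_dotProduct,
      consensusProj_mulVec]
    simp only [dotProduct_sum, dotProduct_smul, hπ, smul_eq_mul, mul_ite, mul_one, mul_zero,
      Finset.sum_ite_eq, Finset.mem_univ, if_true, zero_sub]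
  -- The functionals `π k` are left eigenvectors of `B̄' - P` for `-1`, so they vanish on
  -- eigenvectors whose eigenvalue has nonnegative real part. There `P` is invisible and the
  -- analysis of `B̄'` applies.
  have hz : ∀ k, π k ⬝ᵥ a = 0 ∧ π k ⬝ᵥ b = 0 := by
    intro k
    have e1 := hdot k a
    have e2 := hdot k b
    rw [ha, dotProduct_sub, dotProduct_smul, dotProduct_smul, smul_eq_mul, smul_eq_mul] at e1
    rw [hb, dotProduct_add, dotProduct_smul, dotProduct_smul, smul_eq_mul, smul_eq_mul] at e2
    have hne : (1 + σ) ^ 2 + τ ^ 2 ≠ 0 := by positivity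
    constructor
    · exact (mul_eq_zero.1 (show ((1 + σ) ^ 2 + τ ^ 2) * (π k ⬝ᵥ a) = 0 by
        linear_combination (1 + σ) * e1 + τ * e2)).resolve_left hne
    · exact (mul_eq_zero.1 (show ((1 + σ) ^ 2 + τ ^ 2) * (π k ⬝ᵥ b) = 0 by
        linear_combination (1 + σ) * e2 - τ * e1)).resolve_left hne
  have hPa : consensusProj π *ᵥ a = 0 := by simp [consensusProj_mulVec, hz]
  have hPb : consensusProj π *ᵥ b = 0 := by simp [consensusProj_mulVec, hz]
  rw [Matrix.sub_mulVec, hPa, sub_zero] at ha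
  rw [Matrix.sub_mulVec, hPb, sub_zero] at hb
  by_cases hne : σ ^ 2 + τ ^ 2 = 0
  · have hσ0 : σ = 0 := by nlinarith
    have hτ0 : τ = 0 := by nlinarith
    have hzero : ∀ v, BbarMat α β γ p m s2 *ᵥ v = 0 → consensusProj π *ᵥ v = 0 → v = 0 := by
      intro v hv hPv
      have hmem : v ∈ LinearMap.ker (BbarMat α β γ p m s2).mulVecLin := hv
      rw [ker_BbarMat hα hvar hT hg hpos] at hmem
      obtain ⟨c, rfl⟩ := (Submodule.mem_span_range_iff_exists_fun ℝ).1 hmem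
      rw [consensusProj_mulVec] at hPv
      simpa [dotProduct_sum, hπ] using hPv
    rw [hσ0, hτ0] at ha hb
    exact ⟨hzero a (by simpa using ha) hPa, hzero b (by simpa using hb) hPb⟩
  · exact eq_zero_of_BbarMat_eigen hα hvar hg hσ hne ha hb

end Structure

/-! ### Convergence of square-integrable martingales. -/

section Martingale

variable {Ω : Type*} {mΩ : MeasurableSpace Ω} {μ : Measure Ω}

theorem eLpNorm_two_eq {f : Ω → ℝ} (hf : MemLp f 2 μ) :
    eLpNorm f 2 μ = ENNReal.ofReal (√(∫ ω, f ω ^ 2 ∂μ)) := by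
  rw [hf.eLpNorm_eq_integral_rpow_norm (by norm_num) (by norm_num), Real.sqrt_eq_rpow]
  norm_num

/-- A random variable independent of a `σ`-algebra times one measurable for it: moments. -/
theorem memLp_mul_of_indepFun {X Z : Ω → ℝ} (hX : MemLp X 2 μ) (hZ : MemLp Z 2 μ)
    (h : IndepFun X Z μ) :
    MemLp (fun ω => X ω * Z ω) 2 μ ∧
      ∫ ω, (X ω * Z ω) ^ 2 ∂μ = (∫ ω, X ω ^ 2 ∂μ) * ∫ ω, Z ω ^ 2 ∂μ := by
  have hsq : IndepFun (fun ω => X ω ^ 2) (fun ω => Z ω ^ 2) μ :=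
    h.comp (measurable_id.pow_const 2) (measurable_id.pow_const 2)
  constructor
  · refine (memLp_two_iff_integrable_sq
      (hX.aestronglyMeasurable.mul hZ.aestronglyMeasurable)).2 ?_
    have := hsq.integrable_mul hX.integrable_sq hZ.integrable_sq
    refine this.congr (ae_of_all _ fun ω => ?_)
    simp [mul_pow]
  · simp only [mul_pow]
    exact hsq.integral_fun_mul_eq_mul_integral hX.integrable_sq.aestronglyMeasurable
      hZ.integrable_sq.aestronglyMeasurable

theorem integrable_fun_mul {f g : Ω → ℝ} (hf : MemLp f 2 μ) (hg : MemLp g 2 μ) :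
    Integrable (fun ω => f ω * g ω) μ :=
  hf.integrable_mul hg

theorem integral_sq_add_of_orthogonal {f g : Ω → ℝ} (hf : MemLp f 2 μ) (hg : MemLp g 2 μ)
    (h : ∫ ω, f ω * g ω ∂μ = 0) :
    ∫ ω, (f ω + g ω) ^ 2 ∂μ = ∫ ω, f ω ^ 2 ∂μ + ∫ ω, g ω ^ 2 ∂μ := by
  have e : ∀ ω, (f ω + g ω) ^ 2 = f ω ^ 2 + g ω ^ 2 + 2 * (f ω * g ω) := fun ω => by ring
  have hsq : Integrable (fun ω => f ω ^ 2 + g ω ^ 2) μ := hf.integrable_sq.add hg.integrable_sq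
  simp only [e]
  rw [integral_add hsq ((integrable_fun_mul hf hg).const_mul 2),
    integral_add hf.integrable_sq hg.integrable_sq, integral_const_mul, h]
  ring

theorem sq_integral_le [IsProbabilityMeasure μ] {f : Ω → ℝ} (hf : MemLp f 2 μ) :
    (∫ ω, f ω ∂μ) ^ 2 ≤ ∫ ω, f ω ^ 2 ∂μ := by
  have h1 := variance_nonneg f μ
  rw [variance_eq_sub hf] at h1
  simpa using h1

/-- Weighted sums of square integrable martingale differences with summable variances converge
almost surely and in mean square. -/
theorem exists_limit_of_martingale_difference [IsProbabilityMeasure μ] (ℱ : Filtration ℕ mΩ)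
    {m : ℕ → Ω → ℝ} {δ : ℕ → ℝ} (hmeas : ∀ t, StronglyMeasurable[ℱ (t + 1)] (m t))
    (hL2 : ∀ t, MemLp (m t) 2 μ)
    (horth : ∀ t (Y : Ω → ℝ), StronglyMeasurable[ℱ t] Y → MemLp Y 2 μ → ∫ ω, Y ω * m t ω ∂μ = 0)
    (hsum : Summable fun t => δ t ^ 2 * ∫ ω, m t ω ^ 2 ∂μ) :
    ∃ L : Ω → ℝ, Measurable L ∧ MemLp L 2 μ ∧ ∫ ω, L ω ∂μ = 0 ∧
      (∀ᵐ ω ∂μ, Tendsto (fun N => ∑ s ∈ Finset.range N, δ s * m s ω) atTop (𝓝 (L ω))) ∧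
      Tendsto (fun N => ∫ ω, (∑ s ∈ Finset.range N, δ s * m s ω - L ω) ^ 2 ∂μ) atTop (𝓝 0) := by
  set S : ℕ → Ω → ℝ := fun N ω => ∑ s ∈ Finset.range N, δ s * m s ω with hS
  have hSsucc : ∀ N ω, S (N + 1) ω = S N ω + δ N * m N ω := fun N ω => by
    simp only [hS, Finset.sum_range_succ]
  have hSmeas : ∀ N, StronglyMeasurable[ℱ N] (S N) := by
    intro N
    refine Finset.stronglyMeasurable_fun_sum _ fun s hs => ?_
    exact ((hmeas s).mono (ℱ.mono (Finset.mem_range.1 hs))).const_mul _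
  have hSL2 : ∀ N, MemLp (S N) 2 μ := fun N => memLp_finsetSum _ fun s _ => (hL2 s).const_mul _
  set v : ℕ → ℝ := fun t => δ t ^ 2 * ∫ ω, m t ω ^ 2 ∂μ with hv
  have hvnn : ∀ t, 0 ≤ v t := fun t =>
    mul_nonneg (sq_nonneg _) (integral_nonneg fun _ => sq_nonneg _)
  have hvar : ∀ N k, ∫ ω, (S (N + k) ω - S N ω) ^ 2 ∂μ = ∑ s ∈ Finset.range k, v (N + s) := by
    intro N k
    induction k with
    | zero => simp
    | succ k ih =>
      rw [Finset.sum_range_succ, ← ih]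
      have e : ∀ ω, S (N + (k + 1)) ω - S N ω = (S (N + k) ω - S N ω) + δ (N + k) * m (N + k) ω :=
        fun ω => by rw [← add_assoc, hSsucc]; ring
      simp only [e]
      rw [integral_sq_add_of_orthogonal (f := fun ω => S (N + k) ω - S N ω)
        ((hSL2 _).sub (hSL2 _)) ((hL2 _).const_mul _)]
      · simp only [mul_pow, integral_const_mul, hv]
      · have := horth (N + k) (fun ω => S (N + k) ω - S N ω)
          ((hSmeas _).sub ((hSmeas N).mono (ℱ.mono (Nat.le_add_right N k))))
          ((hSL2 _).sub (hSL2 _))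
        simp only [mul_left_comm _ (δ _)]
        rw [integral_const_mul, this, mul_zero]
  have htail : ∀ N k, ∑ s ∈ Finset.range k, v (N + s) ≤ ∑' s, v (N + s) := fun N k =>
    Summable.sum_le_tsum _ (fun s _ => hvnn _)
      (by simpa only [add_comm] using (summable_nat_add_iff N).2 hsum)
  -- Orthogonality to all past square-integrable variables, tested on indicators of past events, is
  -- the martingale property.
  have hmart : Martingale S ℱ μ := by
    refine martingale_of_setIntegral_eq_succ hSmeas (fun N => (hSL2 N).integrable (by norm_num)) ?_
    intro N s hs
    simp only [hSsucc]
    rw [integral_add ((hSL2 N).integrable (by norm_num)).integrableOn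
      (((hL2 N).integrable (by norm_num)).const_mul _).integrableOn, integral_const_mul]
    have := horth N (s.indicator fun _ => 1) (stronglyMeasurable_const.indicator hs)
      ((memLp_const 1).indicator (ℱ.le N s hs))
    have e : ∀ ω, s.indicator (fun _ => (1 : ℝ)) ω * m N ω = s.indicator (m N) ω := fun ω => by
      by_cases h : ω ∈ s <;> simp [h]
    simp only [e] at this
    rw [integral_indicator (ℱ.le N s hs)] at this
    rw [this, mul_zero, add_zero]
  have hbdd : ∀ N, eLpNorm (S N) 2 μ ≤ (√(∑' s, v (0 + s))).toNNReal := by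
    intro N
    rw [eLpNorm_two_eq (hSL2 N), ← ENNReal.ofReal.eq_1]
    refine ENNReal.ofReal_le_ofReal (Real.sqrt_le_sqrt ?_)
    have := (hvar 0 N).trans_le (htail 0 N)
    simpa [hS] using this
  have hbdd1 : ∀ N, eLpNorm (S N) 1 μ ≤ (√(∑' s, v (0 + s))).toNNReal := fun N =>
    (eLpNorm_le_eLpNorm_of_exponent_le (by norm_num) (hSL2 N).aestronglyMeasurable).trans (hbdd N)
  obtain ⟨L, hLmeas, hLL2, hae⟩ : ∃ L : Ω → ℝ, Measurable L ∧ MemLp L 2 μ ∧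
      ∀ᵐ ω ∂μ, Tendsto (fun N => S N ω) atTop (𝓝 (L ω)) :=
    ⟨_, Filtration.stronglyMeasurable_limit_process'.measurable,
      hmart.submartingale.memLp_limitProcess hbdd,
      hmart.submartingale.ae_tendsto_limitProcess hbdd1⟩
  have hle : ∀ N, ∫ ω, (S N ω - L ω) ^ 2 ∂μ ≤ ∑' s, v (N + s) := by
    intro N
    have hdiff : ∀ k, MemLp (fun ω => S (N + k) ω - S N ω) 2 μ := fun k => (hSL2 _).sub (hSL2 _)
    have hLd : MemLp (fun ω => L ω - S N ω) 2 μ := hLL2.sub (hSL2 N)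
    -- Fatou's lemma transfers the variance bound on `S (N + k) - S N` to `L - S N`.
    have h1 := Lp.eLpNorm_lim_le_liminf_eLpNorm (μ := μ) (p := 2)
      (f := fun k ω => S (N + k) ω - S N ω) (fun k => (hdiff k).aestronglyMeasurable)
      (fun ω => L ω - S N ω) (by
        filter_upwards [hae] with ω hω
        refine Tendsto.sub_const ?_ _
        have := hω.comp (tendsto_add_atTop_nat N)
        simpa only [Function.comp_def, add_comm] using this)
    have h2 : eLpNorm (fun ω => L ω - S N ω) 2 μ ≤ ENNReal.ofReal (√(∑' s, v (N + s))) := by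
      refine h1.trans (liminf_le_of_frequently_le' (Frequently.of_forall fun k => ?_))
      rw [eLpNorm_two_eq (hdiff k), hvar]
      exact ENNReal.ofReal_le_ofReal (Real.sqrt_le_sqrt (htail N k))
    rw [eLpNorm_two_eq hLd, ENNReal.ofReal_le_ofReal_iff (Real.sqrt_nonneg _),
      Real.sqrt_le_sqrt_iff (tsum_nonneg fun s => hvnn _)] at h2
    refine (le_of_eq ?_).trans h2
    congr 1 with ω
    ring
  have hlim : Tendsto (fun N => ∫ ω, (S N ω - L ω) ^ 2 ∂μ) atTop (𝓝 0) := by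
    refine squeeze_zero (fun N => integral_nonneg fun _ => sq_nonneg _) hle ?_
    simpa only [add_comm] using tendsto_sum_nat_add v
  refine ⟨L, hLmeas, hLL2, ?_, hae, hlim⟩
  have hSint : ∀ N, ∫ ω, S N ω ∂μ = 0 := by
    intro N
    simp only [hS]
    rw [integral_finsetSum _ fun s _ => ((hL2 s).integrable (by norm_num)).const_mul _]
    refine Finset.sum_eq_zero fun s _ => ?_
    have := horth s (fun _ => 1) stronglyMeasurable_const (memLp_const 1)
    simp only [one_mul] at this
    rw [integral_const_mul, this, mul_zero]
  -- The partial sums have mean zero, so mean square convergence forces the mean of `L` to vanish.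
  have h0 : ∀ N, (∫ ω, L ω ∂μ) ^ 2 ≤ ∫ ω, (S N ω - L ω) ^ 2 ∂μ := by
    intro N
    have := sq_integral_le ((hSL2 N).sub hLL2)
    simp only [Pi.sub_apply] at this
    rw [integral_sub ((hSL2 N).integrable (by norm_num)) (hLL2.integrable (by norm_num)),
      hSint, zero_sub, neg_sq] at this
    exact this
  have := ge_of_tendsto' hlim h0
  exact pow_eq_zero_iff two_ne_zero |>.1 (le_antisymm this (sq_nonneg _))

end Martingale

/-! ### Square-integrable random vectors. -/

section Vector

variable {Ω ι : Type*} {mΩ : MeasurableSpace Ω} {μ : Measure Ω} [Fintype ι]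

theorem memLp_mulVec {v : Ω → ι → ℝ} (hv : ∀ q, MemLp (fun ω => v ω q) 2 μ) {κ : Type*}
    (M : Matrix κ ι ℝ) (q : κ) : MemLp (fun ω => (M *ᵥ v ω) q) 2 μ :=
  memLp_finsetSum _ fun l _ => (hv l).const_mul _

theorem memLp_const_add {ι : Type*} [IsFiniteMeasure μ] {v : Ω → ι → ℝ}
    (hv : ∀ q, MemLp (fun ω => v ω q) 2 μ) (a : ι → ℝ) (q : ι) : MemLp (fun ω => (a + v ω) q) 2 μ :=
  (memLp_const (a q)).add (hv q)

theorem stronglyMeasurable_mulVec {m : MeasurableSpace Ω} {v : Ω → ι → ℝ}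
    (hv : ∀ q, StronglyMeasurable[m] (fun ω => v ω q)) {κ : Type*} (M : Matrix κ ι ℝ) (q : κ) :
    StronglyMeasurable[m] (fun ω => (M *ᵥ v ω) q) :=
  Finset.stronglyMeasurable_fun_sum _ fun l _ => (hv l).const_mul _

theorem integrable_dotProduct {v w : Ω → ι → ℝ} (hv : ∀ q, MemLp (fun ω => v ω q) 2 μ)
    (hw : ∀ q, MemLp (fun ω => w ω q) 2 μ) : Integrable (fun ω => v ω ⬝ᵥ w ω) μ :=
  integrable_finsetSum _ fun q _ => (hv q).integrable_mul (hw q)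

theorem integral_dotProduct_self {v : Ω → ι → ℝ} (hv : ∀ q, MemLp (fun ω => v ω q) 2 μ) :
    ∫ ω, v ω ⬝ᵥ v ω ∂μ = ∑ q, ∫ ω, v ω q ^ 2 ∂μ := by
  simp only [dotProduct, sq]
  exact integral_finsetSum _ fun q _ => (hv q).integrable_mul (hv q)

theorem dotProduct_self_nonneg (v : ι → ℝ) : 0 ≤ v ⬝ᵥ v :=
  Finset.sum_nonneg fun _ _ => mul_self_nonneg _

theorem sq_le_dotProduct_self (v : ι → ℝ) (q : ι) : v q ^ 2 ≤ v ⬝ᵥ v := by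
  rw [dotProduct, sq]
  exact Finset.single_le_sum (f := fun i => v i * v i) (fun _ _ => mul_self_nonneg _)
    (Finset.mem_univ q)

theorem mulVec_dotProduct_mulVec_le (M N : Matrix ι ι ℝ) :
    ∃ K : ℝ, 0 ≤ K ∧ ∀ v : ι → ℝ, (M *ᵥ v) ⬝ᵥ N *ᵥ (M *ᵥ v) ≤ K * (v ⬝ᵥ v) := by
  refine ⟨∑ i, ∑ j, |(Mᵀ * N * M) i j|,
    Finset.sum_nonneg fun i _ => Finset.sum_nonneg fun j _ => abs_nonneg _, fun v => ?_⟩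
  refine (le_of_eq ?_).trans (dotProduct_mulVec_le (Mᵀ * N * M) v)
  rw [mul_assoc, ← Matrix.mulVec_mulVec, ← Matrix.mulVec_mulVec, Matrix.dotProduct_mulVec v,
    Matrix.vecMul_transpose]

end Vector

/-! ### Linear stochastic approximation with a semisimple zero eigenvalue. -/

section StochasticApproximation

variable {Ω ι : Type*} {mΩ : MeasurableSpace Ω} {μ : Measure Ω} [Fintype ι]

/-- Lyapunov decrease for one explicit Euler step. -/
theorem lyapunov_step {A Q : Matrix ι ι ℝ} {c : ℝ} (hQs : Q.IsSymm)
    (hQ1 : ∀ v, v ⬝ᵥ v ≤ v ⬝ᵥ Q *ᵥ v)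
    (hQA : ∀ v, v ⬝ᵥ Q *ᵥ (A *ᵥ v) ≤ -c * (v ⬝ᵥ Q *ᵥ v)) :
    ∃ K : ℝ, 0 ≤ K ∧ ∀ h : ℝ, 0 ≤ h → ∀ v, (v + h • (A *ᵥ v)) ⬝ᵥ Q *ᵥ (v + h • (A *ᵥ v)) ≤
      (1 - 2 * c * h + K * h ^ 2) * (v ⬝ᵥ Q *ᵥ v) := by
  obtain ⟨K, hK, hKv⟩ := mulVec_dotProduct_mulVec_le A Q
  refine ⟨K, hK, fun h hh v => ?_⟩
  have hcomm : (A *ᵥ v) ⬝ᵥ Q *ᵥ v = v ⬝ᵥ Q *ᵥ (A *ᵥ v) := by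
    rw [Matrix.dotProduct_mulVec, ← Matrix.mulVec_transpose, hQs, dotProduct_comm]
  simp only [Matrix.mulVec_add, Matrix.mulVec_smul, dotProduct_add, add_dotProduct, smul_dotProduct,
    dotProduct_smul, smul_eq_mul, hcomm]
  have h1 := mul_le_mul_of_nonneg_left (hQA v) hh
  have h2 := mul_le_mul_of_nonneg_left ((hKv v).trans (mul_le_mul_of_nonneg_left (hQ1 v) hK))
    (mul_self_nonneg h)
  nlinarith

/-- Along one path: the component driven by a Hurwitz matrix is damped out. -/
theorem tendsto_zero_of_perturbed {A Q R : Matrix ι ι ℝ} {c : ℝ} (hc : 0 < c) (hQs : Q.IsSymm)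
    (hQ1 : ∀ v, v ⬝ᵥ v ≤ v ⬝ᵥ Q *ᵥ v)
    (hQA : ∀ v, v ⬝ᵥ Q *ᵥ (A *ᵥ v) ≤ -c * (v ⬝ᵥ Q *ᵥ v)) {δ : ℕ → ℝ} (hδ : ∀ t, 0 < δ t)
    (hδsum : Tendsto (fun N => ∑ t ∈ Finset.range N, δ t) atTop atTop)
    (hδ0 : Tendsto δ atTop (𝓝 0)) {z m : ℕ → ι → ℝ} {L : ι → ℝ}
    (hz : ∀ t, z (t + 1) = z t + δ t • (A *ᵥ z t) + δ t • (R *ᵥ m t))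
    (hL : Tendsto (fun N => ∑ s ∈ Finset.range N, δ s • m s) atTop (𝓝 L)) :
    Tendsto z atTop (𝓝 0) := by
  set d : ℕ → ι → ℝ := fun N => ∑ s ∈ Finset.range N, δ s • m s - L with hd
  have hd0 : Tendsto d atTop (𝓝 0) := by simpa using hL.sub_const L
  have hcontv : ∀ M : Matrix ι ι ℝ, Continuous fun v : ι → ℝ => M *ᵥ v := fun M =>
    Continuous.matrix_mulVec continuous_const continuous_id
  have hRd : Tendsto (fun t => R *ᵥ d t) atTop (𝓝 0) := by
    have := ((hcontv R).tendsto 0).comp hd0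
    simpa [Function.comp_def] using this
  -- The noise increments are not small relative to `δ`, but their partial sums converge.
  -- Subtracting `R d`, with `d` the distance of the partial sums to their limit, replaces them by
  -- the perturbation `A R d`, which tends to zero.
  set y : ℕ → ι → ℝ := fun t => z t - R *ᵥ d t with hy
  set e : ℕ → ι → ℝ := fun t => A *ᵥ (R *ᵥ d t) with he
  have hee : Tendsto (fun t => e t ⬝ᵥ Q *ᵥ e t) atTop (𝓝 0) := by
    have hcont : Continuous fun v : ι → ℝ => (A *ᵥ v) ⬝ᵥ Q *ᵥ (A *ᵥ v) :=
      (hcontv A).dotProduct ((hcontv Q).comp (hcontv A))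
    have := (hcont.tendsto 0).comp hRd
    simp only [Function.comp_def, Matrix.mulVec_zero, dotProduct_zero] at this
    exact this
  have hysucc : ∀ t, y (t + 1) = (y t + δ t • (A *ᵥ y t)) + δ t • e t := by
    intro t
    have : d (t + 1) = d t + δ t • m t := by
      simp only [hd, Finset.sum_range_succ]
      abel
    simp only [hy, he, hz, this, Matrix.mulVec_add, Matrix.mulVec_sub, Matrix.mulVec_smul, smul_sub]
    abel
  obtain ⟨K, hK, hstep⟩ := lyapunov_step hQs hQ1 hQA
  have hQnn : ∀ v, 0 ≤ v ⬝ᵥ Q *ᵥ v := fun v => (dotProduct_self_nonneg v).trans (hQ1 v)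
  have hyoung : ∀ (h : ℝ) (u w : ι → ℝ), 0 ≤ h → (u + h • w) ⬝ᵥ Q *ᵥ (u + h • w) ≤
      (1 + c * h) * (u ⬝ᵥ Q *ᵥ u) + h * ((h + c⁻¹) * (w ⬝ᵥ Q *ᵥ w)) := by
    intro h u w hh
    have hcomm : w ⬝ᵥ Q *ᵥ u = u ⬝ᵥ Q *ᵥ w := by
      rw [Matrix.dotProduct_mulVec, ← Matrix.mulVec_transpose, hQs, dotProduct_comm]
    -- Young's inequality for the cross term, from the `Q`-square of `c u - w` weighted by `h / c`.
    have h0 := mul_nonneg (mul_nonneg hh (inv_nonneg.2 hc.le)) (hQnn (c • u - w))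
    simp only [Matrix.mulVec_add, Matrix.mulVec_sub, Matrix.mulVec_smul, dotProduct_add,
      add_dotProduct, smul_dotProduct, dotProduct_sub, sub_dotProduct,
      dotProduct_smul, smul_eq_mul, hcomm] at h0 ⊢
    have e1 : h * c⁻¹ * (c * (c * (u ⬝ᵥ Q *ᵥ u)) - c * (u ⬝ᵥ Q *ᵥ w) -
        (c * (u ⬝ᵥ Q *ᵥ w) - w ⬝ᵥ Q *ᵥ w)) = c * h * (u ⬝ᵥ Q *ᵥ u) - 2 * (h * (u ⬝ᵥ Q *ᵥ w)) +
        h * (c⁻¹ * (w ⬝ᵥ Q *ᵥ w)) := by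
      field_simp
      ring
    have e2 : h * c⁻¹ * (c * (c * (u ⬝ᵥ Q *ᵥ u)) - c * (u ⬝ᵥ Q *ᵥ w) -
        (c * (u ⬝ᵥ Q *ᵥ w) - w ⬝ᵥ Q *ᵥ w)) ≥ 0 := by
      refine h0.trans (le_of_eq ?_)
      ring
    rw [e1] at e2
    linarith
  have hy0 : Tendsto (fun t => y t ⬝ᵥ Q *ᵥ y t) atTop (𝓝 0) := by
    -- Of the rate `2 c`, one `c` pays for the cross term and `c / 2` for the quadratic term of the
    -- Euler step, leaving `c / 2`.
    refine tendsto_zero_of_contraction (δ := δ) (c := c / 2)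
      (ε := fun t => (δ t + c⁻¹) * (e t ⬝ᵥ Q *ᵥ e t)) (by positivity) (fun t => hQnn _) hδ hδsum hδ0
      ?_ ?_
    · simpa using (hδ0.add_const c⁻¹).mul hee
    · have h1 : ∀ᶠ t in atTop, (1 + c * δ t) * K * δ t < c / 2 := by
        have : Tendsto (fun t => (1 + c * δ t) * K * δ t) atTop (𝓝 ((1 + c * 0) * K * 0)) :=
          (((hδ0.const_mul c).const_add 1).mul_const K).mul hδ0
        rw [mul_zero] at this
        exact this.eventually_lt_const (by positivity)
      filter_upwards [h1] with t ht
      have hδt := hδ t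
      rw [hysucc]
      refine (hyoung _ _ _ hδt.le).trans (add_le_add ?_ le_rfl)
      refine (mul_le_mul_of_nonneg_left (hstep _ hδt.le (y t)) (by positivity)).trans ?_
      rw [← mul_assoc]
      refine mul_le_mul_of_nonneg_right ?_ (hQnn _)
      nlinarith [mul_pos hc hδt, mul_pos (mul_pos hc hδt) (mul_pos hc hδt)]
  have hyv : Tendsto y atTop (𝓝 0) := by
    rw [tendsto_pi_nhds]
    intro q
    have hsq : Tendsto (fun t => y t q ^ 2) atTop (𝓝 0) :=
      squeeze_zero (fun t => sq_nonneg _)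
        (fun t => (sq_le_dotProduct_self (y t) q).trans (hQ1 (y t))) hy0
    have := hsq.sqrt
    simp only [Real.sqrt_sq_eq_abs, Real.sqrt_zero] at this
    exact (tendsto_zero_iff_abs_tendsto_zero _).2 this
  have := hyv.add hRd
  simpa [hy] using this

variable [DecidableEq ι] [IsProbabilityMeasure μ]

/-- A linear stochastic approximation scheme `ρ' = ρ + δ (B ρ + D (1 - P) ρ + e)` whose mean matrix
`B` has a semisimple eigenvalue zero, with spectral projection `P`, and is otherwise Hurwitz. -/
theorem linear_stochastic_approximation (ℱ : Filtration ℕ mΩ) {B P Q : Matrix ι ι ℝ} {c : ℝ}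
    (hBP : B * P = 0) (hPB : P * B = 0) (hPP : P * P = P) (hc : 0 < c) (hQs : Q.IsSymm)
    (hQ1 : ∀ v, v ⬝ᵥ v ≤ v ⬝ᵥ Q *ᵥ v)
    (hQA : ∀ v, v ⬝ᵥ Q *ᵥ ((B - P) *ᵥ v) ≤ -c * (v ⬝ᵥ Q *ᵥ v)) {δ : ℕ → ℝ} (hδ : ∀ t, 0 < δ t)
    (hδsum : Tendsto (fun N => ∑ t ∈ Finset.range N, δ t) atTop atTop)
    (hδsq : Summable fun t => δ t ^ 2)
    {ρ : ℕ → Ω → ι → ℝ} {ρ₀ : ι → ℝ} (hρ0 : ∀ ω, ρ 0 ω = ρ₀)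
    {D : ℕ → Ω → Matrix ι ι ℝ} {e : ℕ → Ω → ι → ℝ}
    (hρ : ∀ t ω, ρ (t + 1) ω =
      ρ t ω + δ t • (B *ᵥ ρ t ω + (D t ω *ᵥ ((1 - P) *ᵥ ρ t ω) + e t ω)))
    (hDm : ∀ t q l, StronglyMeasurable[ℱ (t + 1)] fun ω => D t ω q l)
    (hem : ∀ t q, StronglyMeasurable[ℱ (t + 1)] fun ω => e t ω q)
    (hDi : ∀ t q l (Y : Ω → ℝ), StronglyMeasurable[ℱ t] Y → IndepFun (fun ω => D t ω q l) Y μ)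
    (hei : ∀ t q (Y : Ω → ℝ), StronglyMeasurable[ℱ t] Y → IndepFun (fun ω => e t ω q) Y μ)
    (hD2 : ∀ t q l, MemLp (fun ω => D t ω q l) 2 μ) (he2 : ∀ t q, MemLp (fun ω => e t ω q) 2 μ)
    (hD0 : ∀ t q l, ∫ ω, D t ω q l ∂μ = 0) (he0 : ∀ t q, ∫ ω, e t ω q ∂μ = 0) {C : ℝ}
    (hDC : ∀ t q l, ∫ ω, D t ω q l ^ 2 ∂μ ≤ C) (heC : ∀ t q, ∫ ω, e t ω q ^ 2 ∂μ ≤ C) :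
    (∀ t q, MemLp (fun ω => ρ t ω q) 2 μ) ∧
    ∃ L : Ω → ι → ℝ, (∀ q, Measurable fun ω => L ω q) ∧ (∀ q, MemLp (fun ω => L ω q) 2 μ) ∧
      (∀ q, ∫ ω, L ω q ∂μ = 0) ∧
      (∀ᵐ ω ∂μ, Tendsto (fun t => ρ t ω) atTop (𝓝 (P *ᵥ (ρ₀ + L ω)))) ∧
      ∀ q, Tendsto (fun t => ∫ ω, (ρ t ω q - (P *ᵥ (ρ₀ + L ω)) q) ^ 2 ∂μ) atTop (𝓝 0) := by
  have hδ0 : Tendsto δ atTop (𝓝 0) := by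
    have := hδsq.tendsto_atTop_zero.sqrt
    simpa only [Real.sqrt_sq (hδ _).le, Real.sqrt_zero] using this
  set z : ℕ → Ω → ι → ℝ := fun t ω => (1 - P) *ᵥ ρ t ω with hzdef
  set m : ℕ → Ω → ι → ℝ := fun t ω => D t ω *ᵥ z t ω + e t ω with hmdef
  have hmq : ∀ t ω q, m t ω q = ∑ l, D t ω q l * z t ω l + e t ω q := fun t ω q => rfl
  -- measurability and square integrability of the state
  have hstate : ∀ t, (∀ q, StronglyMeasurable[ℱ t] fun ω => ρ t ω q) ∧
      ∀ q, MemLp (fun ω => ρ t ω q) 2 μ := by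
    intro t
    induction t with
    | zero =>
      simp only [hρ0]
      exact ⟨fun q => stronglyMeasurable_const, fun q => memLp_const _⟩
    | succ t ih =>
      obtain ⟨ih1, ih2⟩ := ih
      have hz1 : ∀ q, StronglyMeasurable[ℱ t] fun ω => z t ω q :=
        stronglyMeasurable_mulVec ih1 _
      have hz2 : ∀ q, MemLp (fun ω => z t ω q) 2 μ := memLp_mulVec ih2 _
      have hmono := ℱ.mono (Nat.le_succ t)
      simp only [hρ]
      constructor <;> intro q
      · refine ((ih1 q).mono hmono).add (StronglyMeasurable.const_smul ?_ (δ t))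
        refine ((stronglyMeasurable_mulVec ih1 B q).mono hmono).add
          (StronglyMeasurable.add ?_ (hem t q))
        exact Finset.stronglyMeasurable_fun_sum _ fun l _ =>
          (hDm t q l).mul ((hz1 l).mono hmono)
      · refine (ih2 q).add (MemLp.const_smul ?_ (δ t))
        refine (memLp_mulVec ih2 B q).add (MemLp.add ?_ (he2 t q))
        exact memLp_finsetSum _ fun l _ =>
          (memLp_mul_of_indepFun (hD2 t q l) (hz2 l) (hDi t q l _ (hz1 l))).1
  have hz1 : ∀ t q, StronglyMeasurable[ℱ t] fun ω => z t ω q := fun t =>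
    stronglyMeasurable_mulVec (hstate t).1 _
  have hz2 : ∀ t q, MemLp (fun ω => z t ω q) 2 μ := fun t => memLp_mulVec (hstate t).2 _
  have hDz : ∀ t q l, MemLp (fun ω => D t ω q l * z t ω l) 2 μ ∧
      ∫ ω, (D t ω q l * z t ω l) ^ 2 ∂μ = (∫ ω, D t ω q l ^ 2 ∂μ) * ∫ ω, z t ω l ^ 2 ∂μ :=
    fun t q l => memLp_mul_of_indepFun (hD2 t q l) (hz2 t l) (hDi t q l _ (hz1 t l))
  have hm1 : ∀ t q, StronglyMeasurable[ℱ (t + 1)] fun ω => m t ω q := fun t q =>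
    StronglyMeasurable.add (Finset.stronglyMeasurable_fun_sum _ fun l _ =>
      (hDm t q l).mul ((hz1 t l).mono (ℱ.mono (Nat.le_succ t)))) (hem t q)
  have hm2 : ∀ t q, MemLp (fun ω => m t ω q) 2 μ := fun t q =>
    MemLp.add (memLp_finsetSum _ fun l _ => (hDz t q l).1) (he2 t q)
  -- orthogonality of the martingale differences to the past
  have horth : ∀ q t (Y : Ω → ℝ), StronglyMeasurable[ℱ t] Y → MemLp Y 2 μ →
      ∫ ω, Y ω * m t ω q ∂μ = 0 := by
    intro q t Y hY hY2
    simp only [hmq, mul_add, Finset.mul_sum]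
    have hi1 : ∀ l, Integrable (fun ω => Y ω * (D t ω q l * z t ω l)) μ := fun l =>
      integrable_fun_mul hY2 (hDz t q l).1
    rw [integral_add (integrable_finsetSum _ fun l _ => hi1 l) (integrable_fun_mul hY2 (he2 t q)),
      integral_finsetSum _ fun l _ => hi1 l]
    have h1 : ∀ l, ∫ ω, Y ω * (D t ω q l * z t ω l) ∂μ = 0 := by
      intro l
      have hYz : StronglyMeasurable[ℱ t] fun ω => Y ω * z t ω l := hY.mul (hz1 t l)
      have := (hDi t q l _ hYz).integral_fun_mul_eq_mul_integral
        (hD2 t q l).aestronglyMeasurable (hYz.mono (ℱ.le t)).aestronglyMeasurable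
      rw [hD0, zero_mul] at this
      rw [← this]
      congr 1 with ω
      ring
    have h2 : ∫ ω, Y ω * e t ω q ∂μ = 0 := by
      have := (hei t q _ hY).integral_fun_mul_eq_mul_integral
        (he2 t q).aestronglyMeasurable (hY.mono (ℱ.le t)).aestronglyMeasurable
      rw [he0, zero_mul] at this
      rw [← this]
      congr 1 with ω
      ring
    simp [h1, h2]
  -- conditional variance bound
  set V : ℕ → ℝ := fun t => ∫ ω, z t ω ⬝ᵥ Q *ᵥ z t ω ∂μ with hV
  have hQz2 : ∀ t q, MemLp (fun ω => (Q *ᵥ z t ω) q) 2 μ := fun t => memLp_mulVec (hz2 t) Q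
  have hVint : ∀ t, Integrable (fun ω => z t ω ⬝ᵥ Q *ᵥ z t ω) μ := fun t =>
    integrable_dotProduct (hz2 t) (hQz2 t)
  have hzV : ∀ t, ∑ l, ∫ ω, z t ω l ^ 2 ∂μ ≤ V t := by
    intro t
    rw [← integral_dotProduct_self (hz2 t)]
    exact integral_mono (integrable_dotProduct (hz2 t) (hz2 t)) (hVint t) fun ω => hQ1 _
  have hVnn : ∀ t, 0 ≤ V t := fun t =>
    (Finset.sum_nonneg fun l _ => integral_nonneg fun ω => sq_nonneg _).trans (hzV t)
  -- Cauchy–Schwarz constant for the sum of `card ι` products `D z` and the single term `e`.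
  set k : ℝ := Fintype.card ι + 1 with hk
  have hk0 : 0 ≤ k := by positivity
  have hmV : ∀ t q, ∫ ω, m t ω q ^ 2 ∂μ ≤ k * C * (1 + V t) := by
    intro t q
    have hpt : ∀ ω, m t ω q ^ 2 ≤ k * (∑ l, (D t ω q l * z t ω l) ^ 2 + e t ω q ^ 2) := by
      intro ω
      have := sq_sum_le_card_mul_sum_sq (s := (Finset.univ : Finset (Option ι)))
        (f := fun o => o.elim (e t ω q) fun l => D t ω q l * z t ω l)
      simp only [Fintype.sum_option, Option.elim_none, Option.elim_some, Finset.card_univ,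
        Fintype.card_option] at this
      rw [hmq, hk, add_comm (∑ l, _) (e t ω q), add_comm (∑ l, _) (e t ω q ^ 2)]
      exact_mod_cast this
    have hint : Integrable (fun ω => ∑ l, (D t ω q l * z t ω l) ^ 2) μ :=
      integrable_finsetSum _ fun l _ => (hDz t q l).1.integrable_sq
    have h1 := integral_mono (hm2 t q).integrable_sq
      ((hint.add (he2 t q).integrable_sq).const_mul k) hpt
    refine h1.trans ?_
    rw [integral_const_mul, mul_assoc]
    refine mul_le_mul_of_nonneg_left ?_ hk0
    have h2 : ∫ ω, (∑ l, (D t ω q l * z t ω l) ^ 2 + e t ω q ^ 2) ∂μ =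
        ∑ l, (∫ ω, D t ω q l ^ 2 ∂μ) * ∫ ω, z t ω l ^ 2 ∂μ + ∫ ω, e t ω q ^ 2 ∂μ := by
      rw [integral_add hint (he2 t q).integrable_sq,
        integral_finsetSum _ fun l _ => (hDz t q l).1.integrable_sq]
      simp only [(hDz t q _).2]
    refine h2.le.trans ?_
    have hC0 : 0 ≤ C := (integral_nonneg fun ω => sq_nonneg _).trans (heC t q)
    have h3 : ∑ l, (∫ ω, D t ω q l ^ 2 ∂μ) * ∫ ω, z t ω l ^ 2 ∂μ ≤ C * V t := by
      calc _ ≤ ∑ l, C * ∫ ω, z t ω l ^ 2 ∂μ := Finset.sum_le_sum fun l _ =>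
            mul_le_mul_of_nonneg_right (hDC t q l) (integral_nonneg fun ω => sq_nonneg _)
        _ = C * ∑ l, ∫ ω, z t ω l ^ 2 ∂μ := by rw [Finset.mul_sum]
        _ ≤ C * V t := mul_le_mul_of_nonneg_left (hzV t) hC0
    linarith [heC t q]
  -- the damped component
  set A := B - P with hA
  set R : Matrix ι ι ℝ := 1 - P with hR
  -- On the range of `1 - P` the Hurwitz matrix `B - P` acts as `B`, so `z` obeys a recursion of its
  -- own with a Lyapunov function.
  have hARB : A * R = B := by
    rw [hA, hR, sub_mul, mul_sub, mul_sub, hBP, hPP]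
    simp
  have hRB : R * B = B := by rw [hR, sub_mul, hPB, one_mul, sub_zero]
  have hzsucc : ∀ t ω, z (t + 1) ω = z t ω + δ t • (A *ᵥ z t ω) + δ t • (R *ᵥ m t ω) := by
    intro t ω
    change R *ᵥ ρ (t + 1) ω = R *ᵥ ρ t ω + δ t • (A *ᵥ (R *ᵥ ρ t ω)) + δ t • (R *ᵥ m t ω)
    have h1 : A *ᵥ (R *ᵥ ρ t ω) = B *ᵥ ρ t ω := by rw [Matrix.mulVec_mulVec, hARB]
    have h2 : R *ᵥ (B *ᵥ ρ t ω) = B *ᵥ ρ t ω := by rw [Matrix.mulVec_mulVec, hRB]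
    rw [hρ, Matrix.mulVec_add, Matrix.mulVec_smul, Matrix.mulVec_add, h1, h2, smul_add, add_assoc]
  have hPsucc : ∀ N ω, P *ᵥ ρ N ω = P *ᵥ (ρ₀ + ∑ s ∈ Finset.range N, δ s • m s ω) := by
    intro N ω
    induction N with
    | zero => simp [hρ0]
    | succ N ih =>
      rw [Finset.sum_range_succ, ← add_assoc, Matrix.mulVec_add, ← ih, hρ, Matrix.mulVec_add,
        Matrix.mulVec_smul, Matrix.mulVec_add, Matrix.mulVec_mulVec, hPB, Matrix.zero_mulVec,
        zero_add, Matrix.mulVec_smul]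
  obtain ⟨K, hK, hstep⟩ := lyapunov_step hQs hQ1 hQA
  obtain ⟨K', hK', hRQ⟩ := mulVec_dotProduct_mulVec_le R Q
  set J : ℝ := K' * (Fintype.card ι * (k * C)) with hJ
  have hVsucc : ∀ t,
      V (t + 1) ≤ (1 - 2 * c * δ t + K * δ t ^ 2) * V t + δ t ^ 2 * (J * (1 + V t)) := by
    intro t
    set u : Ω → ι → ℝ := fun ω => z t ω + δ t • (A *ᵥ z t ω) with hu
    set r : Ω → ι → ℝ := fun ω => R *ᵥ m t ω with hr
    have hu1 : ∀ q, StronglyMeasurable[ℱ t] fun ω => u ω q := fun q =>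
      (hz1 t q).add ((stronglyMeasurable_mulVec (hz1 t) A q).const_smul (δ t))
    have hu2 : ∀ q, MemLp (fun ω => u ω q) 2 μ := fun q =>
      (hz2 t q).add ((memLp_mulVec (hz2 t) A q).const_smul (δ t))
    have hr2 : ∀ q, MemLp (fun ω => r ω q) 2 μ := memLp_mulVec (hm2 t) R
    -- The predicted state `u` is determined by the past, so the noise enters the mean of the
    -- Lyapunov function only at order `δ²`.
    have hcross : ∫ ω, u ω ⬝ᵥ Q *ᵥ r ω ∂μ = 0 := by
      have e1 : ∀ ω, u ω ⬝ᵥ Q *ᵥ r ω = ∑ q, ((Q * R)ᵀ *ᵥ u ω) q * m t ω q := by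
        intro ω
        rw [hr, Matrix.mulVec_mulVec, Matrix.dotProduct_mulVec, ← Matrix.mulVec_transpose]
        rfl
      simp only [e1]
      rw [integral_finsetSum _ fun q _ => integrable_fun_mul (memLp_mulVec hu2 _ q) (hm2 t q)]
      exact Finset.sum_eq_zero fun q _ =>
        horth q t _ (stronglyMeasurable_mulVec hu1 _ q) (memLp_mulVec hu2 _ q)
    have hexp : ∀ ω, z (t + 1) ω ⬝ᵥ Q *ᵥ z (t + 1) ω =
        u ω ⬝ᵥ Q *ᵥ u ω + (2 * δ t * (u ω ⬝ᵥ Q *ᵥ r ω) + δ t ^ 2 * (r ω ⬝ᵥ Q *ᵥ r ω)) := by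
      intro ω
      have hcomm : r ω ⬝ᵥ Q *ᵥ u ω = u ω ⬝ᵥ Q *ᵥ r ω := by
        rw [Matrix.dotProduct_mulVec, ← Matrix.mulVec_transpose, hQs, dotProduct_comm]
      have : z (t + 1) ω = u ω + δ t • r ω := hzsucc t ω
      rw [this]
      simp only [Matrix.mulVec_add, Matrix.mulVec_smul, dotProduct_add, add_dotProduct,
        smul_dotProduct, dotProduct_smul, smul_eq_mul, hcomm]
      ring
    have i1 : Integrable (fun ω => u ω ⬝ᵥ Q *ᵥ u ω) μ :=
      integrable_dotProduct hu2 (memLp_mulVec hu2 Q)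
    have i2 : Integrable (fun ω => u ω ⬝ᵥ Q *ᵥ r ω) μ :=
      integrable_dotProduct hu2 (memLp_mulVec hr2 Q)
    have i3 : Integrable (fun ω => r ω ⬝ᵥ Q *ᵥ r ω) μ :=
      integrable_dotProduct hr2 (memLp_mulVec hr2 Q)
    have i4 : Integrable (fun ω => 2 * δ t * (u ω ⬝ᵥ Q *ᵥ r ω) + δ t ^ 2 * (r ω ⬝ᵥ Q *ᵥ r ω)) μ :=
      (i2.const_mul _).add (i3.const_mul _)
    have hVeq : V (t + 1) = ∫ ω, u ω ⬝ᵥ Q *ᵥ u ω ∂μ + δ t ^ 2 * ∫ ω, r ω ⬝ᵥ Q *ᵥ r ω ∂μ := by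
      simp only [hV, hexp]
      rw [integral_add i1 i4, integral_add (i2.const_mul _) (i3.const_mul _), integral_const_mul,
        integral_const_mul, hcross]
      ring
    have b1 : ∫ ω, u ω ⬝ᵥ Q *ᵥ u ω ∂μ ≤ (1 - 2 * c * δ t + K * δ t ^ 2) * V t := by
      rw [hV, ← integral_const_mul]
      exact integral_mono i1 ((hVint t).const_mul _) fun ω => hstep _ (hδ t).le _
    have b2 : ∫ ω, r ω ⬝ᵥ Q *ᵥ r ω ∂μ ≤ J * (1 + V t) := by
      calc ∫ ω, r ω ⬝ᵥ Q *ᵥ r ω ∂μ ≤ ∫ ω, K' * (m t ω ⬝ᵥ m t ω) ∂μ :=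
            integral_mono i3 ((integrable_dotProduct (hm2 t) (hm2 t)).const_mul _) fun ω => hRQ _
        _ = K' * ∑ q, ∫ ω, m t ω q ^ 2 ∂μ := by
          rw [integral_const_mul, integral_dotProduct_self (hm2 t)]
        _ ≤ K' * ∑ _q : ι, k * C * (1 + V t) :=
          mul_le_mul_of_nonneg_left (Finset.sum_le_sum fun q _ => hmV t q) hK'
        _ = J * (1 + V t) := by
          rw [Finset.sum_const, Finset.card_univ, nsmul_eq_mul, hJ]
          ring
    rw [hVeq]
    exact add_le_add b1 (mul_le_mul_of_nonneg_left b2 (sq_nonneg _))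
  -- Once `(K + J) δ < c`, half of the rate `2 c` absorbs the `δ²` multiples of `V`; the remaining
  -- error is `δ * (δ J)`.
  have hV0 : Tendsto V atTop (𝓝 0) := by
    refine tendsto_zero_of_contraction (δ := δ) (ε := fun t => δ t * J) hc hVnn hδ hδsum hδ0
      (by simpa using hδ0.mul_const J) ?_
    have h1 : ∀ᶠ t in atTop, (K + J) * δ t < c := by
      have : Tendsto (fun t => (K + J) * δ t) atTop (𝓝 0) := by simpa using hδ0.const_mul (K + J)
      exact this.eventually_lt_const hc
    filter_upwards [h1] with t ht
    have h2 := mul_le_mul_of_nonneg_right (mul_le_mul_of_nonneg_left ht.le (hδ t).le) (hVnn t)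
    nlinarith [hVsucc t]
  obtain ⟨W, hW⟩ := hV0.bddAbove_range
  have hVW : ∀ t, V t ≤ W := fun t => hW ⟨t, rfl⟩
  -- the martingale of accumulated noise
  have hmart := fun q => exists_limit_of_martingale_difference (μ := μ) ℱ
    (m := fun t ω => m t ω q) (δ := δ) (fun t => hm1 t q) (fun t => hm2 t q) (horth q) (by
      refine Summable.of_nonneg_of_le
        (fun t => mul_nonneg (sq_nonneg _) (integral_nonneg fun ω => sq_nonneg _)) (fun t => ?_)
        (hδsq.mul_right (k * C * (1 + W)))
      have hC0 : 0 ≤ C := (integral_nonneg fun ω => sq_nonneg _).trans (heC t q)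
      refine mul_le_mul_of_nonneg_left ((hmV t q).trans ?_) (sq_nonneg _)
      exact mul_le_mul_of_nonneg_left (by linarith [hVW t]) (by positivity))
  choose L hLm hL2 hL0 hLae hLlim using hmart
  refine ⟨fun t => (hstate t).2, fun ω q => L q ω, hLm, hL2, hL0, ?_, fun q => ?_⟩
  · filter_upwards [ae_all_iff.2 hLae] with ω hω
    have hM : Tendsto (fun N => ∑ s ∈ Finset.range N, δ s • m s ω) atTop (𝓝 fun q => L q ω) := by
      rw [tendsto_pi_nhds]
      intro q
      simpa using hω q
    have hzlim := tendsto_zero_of_perturbed (R := R) (z := fun t => z t ω)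
      (m := fun t => m t ω) hc hQs hQ1 hQA hδ hδsum hδ0 (fun t => hzsucc t ω) hM
    have hPlim : Tendsto (fun N => P *ᵥ ρ N ω) atTop (𝓝 (P *ᵥ (ρ₀ + fun q => L q ω))) := by
      simp only [hPsucc]
      have hcont : Continuous fun v : ι → ℝ => P *ᵥ (ρ₀ + v) :=
        Continuous.matrix_mulVec continuous_const (continuous_const.add continuous_id)
      exact (hcont.tendsto _).comp hM
    have := hzlim.add hPlim
    simpa [hzdef, hR, Matrix.sub_mulVec] using this
  · set d : ℕ → Ω → ι → ℝ := fun t ω l => ∑ s ∈ Finset.range t, δ s * m s ω l - L l ω with hd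
    have hd2 : ∀ t l, MemLp (fun ω => d t ω l) 2 μ := fun t l =>
      MemLp.sub (memLp_finsetSum _ fun s _ => (hm2 s l).const_mul _) (hL2 l)
    -- The error splits into the damped component and `P` applied to the tail of the martingale;
    -- both tend to zero in mean square.
    have heq : ∀ t ω, ρ t ω q - (P *ᵥ (ρ₀ + fun q => L q ω)) q = z t ω q + (P *ᵥ d t ω) q := by
      intro t ω
      have h1 : ρ t ω = z t ω + P *ᵥ ρ t ω := by simp [hzdef, hR, Matrix.sub_mulVec]
      have h2 : d t ω = (ρ₀ + ∑ s ∈ Finset.range t, δ s • m s ω) - (ρ₀ + fun q => L q ω) := by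
        ext l
        simp [hd]
      rw [h2, Matrix.mulVec_sub, ← hPsucc]
      nth_rewrite 1 [h1]
      simp only [Pi.add_apply, Pi.sub_apply]
      ring
    simp only [heq]
    set κ : ℝ := ∑ l, P q l ^ 2 with hκ
    have hpt : ∀ t ω, (z t ω q + (P *ᵥ d t ω) q) ^ 2 ≤
        2 * (z t ω ⬝ᵥ Q *ᵥ z t ω) + 2 * (κ * (d t ω ⬝ᵥ d t ω)) := by
      intro t ω
      have h1 := (sq_le_dotProduct_self (z t ω) q).trans (hQ1 _)
      have h2 : (P *ᵥ d t ω) q ^ 2 ≤ κ * (d t ω ⬝ᵥ d t ω) := by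
        have := Finset.sum_mul_sq_le_sq_mul_sq Finset.univ (fun l => P q l) (d t ω)
        simpa only [Matrix.mulVec, dotProduct, ← sq] using this
      nlinarith [sq_nonneg (z t ω q - (P *ᵥ d t ω) q)]
    have hbound : ∀ t, ∫ ω, (z t ω q + (P *ᵥ d t ω) q) ^ 2 ∂μ ≤
        2 * V t + 2 * (κ * ∑ l, ∫ ω, d t ω l ^ 2 ∂μ) := by
      intro t
      have i1 := integrable_dotProduct (hd2 t) (hd2 t)
      have := integral_mono (MemLp.integrable_sq ((hz2 t q).add (memLp_mulVec (hd2 t) P q)))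
        (((hVint t).const_mul 2).add ((i1.const_mul κ).const_mul 2)) (hpt t)
      refine this.trans (le_of_eq ?_)
      simp only [Pi.add_apply]
      rw [integral_add ((hVint t).const_mul 2) ((i1.const_mul κ).const_mul 2), integral_const_mul,
        integral_const_mul, integral_const_mul, integral_dotProduct_self (hd2 t)]
    refine squeeze_zero (fun t => integral_nonneg fun ω => sq_nonneg _) hbound ?_
    have hdl : Tendsto (fun t => ∑ l, ∫ ω, d t ω l ^ 2 ∂μ) atTop (𝓝 (∑ _l : ι, 0)) :=
      tendsto_finsetSum _ fun l _ => hLlim l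
    have := (hV0.const_mul 2).add ((hdl.const_mul κ).const_mul 2)
    simpa using this

end StochasticApproximation

/-! ### Independence of past and present; laws of the link indicators. -/

section Independence

variable {Ω : Type*} {mΩ : MeasurableSpace Ω} {μ : Measure Ω}

/-- The `σ`-algebra generated by the members `X k`, `k ∈ S`, of a family of random variables. -/
abbrev sigmaOf {κ : Type*} (X : κ → Ω → ℝ) (S : Set κ) : MeasurableSpace Ω :=
  ⨆ k ∈ S, MeasurableSpace.comap (X k) inferInstance

theorem measurable_sigmaOf {κ : Type*} (X : κ → Ω → ℝ) {S : Set κ} {k : κ} (hk : k ∈ S) :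
    Measurable[sigmaOf X S] (X k) :=
  (comap_measurable (X k)).mono
    (le_iSup₂_of_le (f := fun k (_ : k ∈ S) => MeasurableSpace.comap (X k) inferInstance)
      k hk le_rfl) le_rfl

theorem indepFun_of_disjoint {κ : Type*} {X : κ → Ω → ℝ} (hX : ∀ k, Measurable (X k))
    (h : iIndepFun X μ) {S T : Set κ} (hST : Disjoint S T) {f g : Ω → ℝ}
    (hf : Measurable[sigmaOf X S] f) (hg : Measurable[sigmaOf X T] g) : IndepFun f g μ := by
  have := indep_iSup_of_disjoint (fun k => (hX k).comap_le) h hST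
  exact indep_of_indep_of_le_left (indep_of_indep_of_le_right this hg.comap_le) hf.comap_le

theorem indepFun_of_compl {κ : Type*} {X : κ → Ω → ℝ} (hX : ∀ k, Measurable (X k))
    (h : iIndepFun X μ) (k : κ) {f g : Ω → ℝ} (hf : Measurable[sigmaOf X {k}] f)
    (hg : Measurable[sigmaOf X {k}ᶜ] g) : IndepFun f g μ :=
  indepFun_of_disjoint hX h disjoint_compl_right hf hg

/-- The history strictly before time `t` of a family of processes. -/
def strictPast {κ : Type*} {X : κ × ℕ → Ω → ℝ} (hX : ∀ k, Measurable (X k)) : Filtration ℕ mΩ where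
  seq t := sigmaOf X {k | k.2 < t}
  mono' _ _ hst := biSup_mono fun _ hk => lt_of_lt_of_le hk hst
  le' _ := iSup₂_le fun k _ => (hX k).comap_le

/-- The law of a variable that takes the values `1` and `0` with total probability one. -/
theorem map_eq_of_zero_one [IsProbabilityMeasure μ] {U : Ω → ℝ} (hU : Measurable U) {p : ℝ}
    (h1 : μ.real {ω | U ω = 1} = p) (h0 : μ.real {ω | U ω = 0} = 1 - p) :
    μ.map U = ENNReal.ofReal p • Measure.dirac 1 + ENNReal.ofReal (1 - p) • Measure.dirac 0 := by
  have e1 : μ.map U {1} = ENNReal.ofReal p := by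
    rw [Measure.map_apply hU (measurableSet_singleton _), ← h1, ofReal_measureReal]
    rfl
  have e0 : μ.map U {0} = ENNReal.ofReal (1 - p) := by
    rw [Measure.map_apply hU (measurableSet_singleton _), ← h0, ofReal_measureReal]
    rfl
  have hp : 0 ≤ p := h1 ▸ measureReal_nonneg
  have hp' : 0 ≤ 1 - p := h0 ▸ measureReal_nonneg
  have : IsProbabilityMeasure (μ.map U) := Measure.isProbabilityMeasure_map hU.aemeasurable
  have hdisj : Disjoint ({1} : Set ℝ) {0} := by simp
  have hms : MeasurableSet ({1} ∪ {0} : Set ℝ) :=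
    (measurableSet_singleton _).union (measurableSet_singleton _)
  have htot : μ.map U ({1} ∪ {0}) = 1 := by
    rw [measure_union hdisj (measurableSet_singleton _), e1, e0, ← ENNReal.ofReal_add hp hp']
    simp
  have hae : ∀ᵐ y ∂(μ.map U), y ∈ ({1} ∪ {0} : Set ℝ) := (prob_compl_eq_zero_iff hms).2 htot
  rw [← e1, ← e0, ← Measure.restrict_singleton, ← Measure.restrict_singleton,
    ← Measure.restrict_union hdisj (measurableSet_singleton _),
    Measure.restrict_eq_self_of_ae_mem hae]

theorem ae_zero_or_one [IsProbabilityMeasure μ] {U : Ω → ℝ} (hU : Measurable U) {p : ℝ}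
    (h1 : μ.real {ω | U ω = 1} = p) (h0 : μ.real {ω | U ω = 0} = 1 - p) :
    ∀ᵐ ω ∂μ, U ω = 1 ∨ U ω = 0 := by
  have : ∀ᵐ y ∂(μ.map U), y ∈ ({1} ∪ {0} : Set ℝ) := by
    rw [map_eq_of_zero_one hU h1 h0, ae_add_measure_iff]
    constructor <;> refine Measure.ae_smul_measure ?_ _ <;> simp
  exact ae_of_ae_map hU.aemeasurable this

theorem memLp_of_zero_one [IsProbabilityMeasure μ] {U : Ω → ℝ} (hU : Measurable U) {p : ℝ}
    (h1 : μ.real {ω | U ω = 1} = p) (h0 : μ.real {ω | U ω = 0} = 1 - p) : MemLp U 2 μ := by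
  refine MemLp.of_bound hU.aestronglyMeasurable 1 ?_
  filter_upwards [ae_zero_or_one hU h1 h0] with ω hω
  rcases hω with h | h <;> simp [h]

theorem integral_of_zero_one [IsProbabilityMeasure μ] {U : Ω → ℝ} (hU : Measurable U) {p : ℝ}
    (h1 : μ.real {ω | U ω = 1} = p) (h0 : μ.real {ω | U ω = 0} = 1 - p) : ∫ ω, U ω ∂μ = p := by
  have : U =ᵐ[μ] {ω | U ω = 1}.indicator fun _ => 1 := by
    filter_upwards [ae_zero_or_one hU h1 h0] with ω hω
    rcases hω with h | h <;> simp [h]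
  rw [integral_congr_ae this, integral_indicator
    (show MeasurableSet {ω | U ω = 1} from hU (measurableSet_singleton 1))]
  simp [h1]

end Independence

/-! ### Moments of the sensor and link matrices. -/

section Moments

variable {Ω : Type*} {mΩ : MeasurableSpace Ω} {μ : Measure Ω}

theorem memLp_sq_of_memLp_four {X : Ω → ℝ} (hX : MemLp X 4 μ) : MemLp (fun ω => X ω ^ 2) 2 μ := by
  refine (memLp_two_iff_integrable_sq (hX.aestronglyMeasurable.pow 2)).2 ?_
  have := hX.integrable_norm_pow (p := 4) (by norm_num)
  refine this.congr (ae_of_all _ fun ω => ?_)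
  simp only [Real.norm_eq_abs]
  rw [Even.pow_abs (by decide), Pi.pow_apply]
  ring

/-- Entries of `Φ` are quadratic in the signal, so their means need two moments of `x` and their
square integrability needs four. -/
theorem Phi_eq_quadratic (α β : ℝ) (k l : Fin 2) :
    ∃ a b c : ℝ, (∀ x, Phi α β x k l = a + b * x + c * x ^ 2) ∧
      ∀ m s2, PhiBar α β m s2 k l = a + b * m + c * s2 := by
  fin_cases k <;> fin_cases l
  · exact ⟨0, α * β, α ^ 2, fun x => by simp [Phi, sensorOutput]; ring,
      fun m s2 => by simp [PhiBar]⟩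
  · exact ⟨α * β, α ^ 2, 0, fun x => by simp [Phi, sensorOutput]; ring,
      fun m s2 => by simp [PhiBar]⟩
  · exact ⟨0, 1 + β ^ 2, α * β, fun x => by simp [Phi, sensorOutput]; ring,
      fun m s2 => by simp [PhiBar]⟩
  · exact ⟨1 + β ^ 2, α * β, 0, fun x => by simp [Phi, sensorOutput]; ring,
      fun m s2 => by simp [PhiBar]⟩

theorem measurable_Phi (α β : ℝ) (k l : Fin 2) : Measurable fun x => Phi α β x k l := by
  obtain ⟨a, b, c, h, -⟩ := Phi_eq_quadratic α β k l
  simp only [h]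
  fun_prop

theorem measurable_Phi_comp {m : MeasurableSpace Ω} {X : Ω → ℝ} (hX : Measurable X) (α β : ℝ)
    (k l : Fin 2) : Measurable fun ω => Phi α β (X ω) k l :=
  (measurable_Phi α β k l).comp hX

theorem memLp_Phi [IsProbabilityMeasure μ] {X : Ω → ℝ} (hX : MemLp X 4 μ) (α β : ℝ) (k l : Fin 2) :
    MemLp (fun ω => Phi α β (X ω) k l) 2 μ ∧
      ∫ ω, Phi α β (X ω) k l ∂μ = PhiBar α β (∫ ω, X ω ∂μ) (∫ ω, X ω ^ 2 ∂μ) k l := by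
  obtain ⟨a, b, c, h, h'⟩ := Phi_eq_quadratic α β k l
  simp only [h, h']
  have h1 : MemLp X 2 μ := hX.mono_exponent (by norm_num)
  have h2 := memLp_sq_of_memLp_four hX
  have i1 : MemLp (fun ω => a + b * X ω) 2 μ := (memLp_const a).add (h1.const_mul b)
  refine ⟨i1.add (h2.const_mul c), ?_⟩
  rw [integral_add (i1.integrable (by norm_num)) ((h2.integrable (by norm_num)).const_mul c),
    integral_add (integrable_const a) ((h1.integrable (by norm_num)).const_mul b),
    integral_const_mul, integral_const_mul]
  simp

theorem memLp_Gam [IsProbabilityMeasure μ] {n : ℕ} {U : Fin n → Fin n → Ω → ℝ}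
    (hU : ∀ i j, MemLp (U i j) 2 μ)
    (γ : Fin n → Fin n → ℝ) (i j : Fin n) :
    MemLp (fun ω => Gam (fun i j => U i j ω * γ i j) i j) 2 μ ∧
      ∫ ω, Gam (fun i j => U i j ω * γ i j) i j ∂μ =
        Gam (fun i j => γ i j * ∫ ω, U i j ω ∂μ) i j := by
  have h : ∀ i j, MemLp (fun ω => U i j ω * γ i j) 2 μ := fun i j => (hU i j).mul_const _
  have hint : ∀ i j, ∫ ω, U i j ω * γ i j ∂μ = γ i j * ∫ ω, U i j ω ∂μ := fun i j => by
    rw [integral_mul_const, mul_comm]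
  by_cases hij : i = j
  · simp only [Gam, Matrix.of_apply, if_pos hij]
    refine ⟨(memLp_finsetSum _ fun k _ => h i k).neg, ?_⟩
    rw [integral_neg, integral_finsetSum _ fun k _ => (h i k).integrable (by norm_num)]
    simp only [hint]
  · simp only [Gam, Matrix.of_apply, if_neg hij]
    exact ⟨h i j, hint i j⟩

theorem measurable_Gam {n : ℕ} {E : Type*} {_ : MeasurableSpace E} {g : Fin n → Fin n → E → ℝ}
    (hg : ∀ i j, Measurable (g i j)) (i j : Fin n) :
    Measurable fun ω => Gam (fun i j => g i j ω) i j := by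
  by_cases hij : i = j
  · simp only [Gam, Matrix.of_apply, if_pos hij]
    fun_prop
  · simp only [Gam, Matrix.of_apply, if_neg hij]
    fun_prop

end Moments

/-! ### The coefficients as functions of the signals at one time. -/

section Assembly

variable {n : ℕ}

/-- The index set of the scalar processes. -/
abbrev ProcIndex (n : ℕ) : Type := Unit ⊕ (Fin n × Fin n) ⊕ (Fin n × Fin n)

/-- `B'` as a function of the vector of all signals at one time. -/
def matOf (α β : Fin n → ℝ) (γ : Fin n → Fin n → ℝ) (s : ProcIndex n → ℝ) :
    Matrix (Fin n × Fin 2) (Fin n × Fin 2) ℝ :=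
  Bmat α β (fun i j => s (.inr (.inl (i, j))) * γ i j) (s (.inl ()))

/-- `ν` as a function of the vector of all signals at one time. -/
def noiseOf (α β : Fin n → ℝ) (γ : Fin n → Fin n → ℝ) (s : ProcIndex n → ℝ) : Fin n × Fin 2 → ℝ :=
  noiseVec α β (fun i j => s (.inr (.inl (i, j))) * γ i j) (fun i j => s (.inr (.inr (i, j))))
    (s (.inl ()))

variable {α β : Fin n → ℝ} {γ : Fin n → Fin n → ℝ}

theorem matOf_apply (s : ProcIndex n → ℝ) (q l : Fin n × Fin 2) :
    matOf α β γ s q l = Phi (α q.1) (β q.1) (s (.inl ())) q.2 l.2 *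
      Gam (fun i j => s (.inr (.inl (i, j))) * γ i j) q.1 l.1 :=
  blockDiag_kronecker_apply _ _ q l

/-- The noise gain is the second column of `Φ`, so the moment bounds for `Φ` also cover the noise.
-/
theorem noise_gain_eq_Phi (α β x : ℝ) (k : Fin 2) :
    (![α * sensorOutput α β x, 1 + β * sensorOutput α β x] : Fin 2 → ℝ) k = Phi α β x k 1 := by
  fin_cases k <;> simp [Phi]

theorem noiseOf_apply (s : ProcIndex n → ℝ) (q : Fin n × Fin 2) :
    noiseOf α β γ s q = ∑ j, γ q.1 j * (s (.inr (.inr (q.1, j))) *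
      (Phi (α q.1) (β q.1) (s (.inl ())) q.2 1 * s (.inr (.inl (q.1, j))))) := by
  rw [noiseOf, noiseVec, noise_gain_eq_Phi, Finset.sum_mul]
  exact Finset.sum_congr rfl fun j _ => by ring

theorem measurable_matOf (q l : Fin n × Fin 2) : Measurable fun s => matOf α β γ s q l := by
  simp only [matOf_apply]
  refine (measurable_Phi_comp (measurable_pi_apply _) _ _ _ _).mul (measurable_Gam ?_ _ _)
  exact fun i j => (measurable_pi_apply _).mul_const _

theorem measurable_noiseOf (q : Fin n × Fin 2) : Measurable fun s => noiseOf α β γ s q := by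
  simp only [noiseOf_apply]
  refine Finset.measurable_fun_sum _ fun j _ => ((measurable_pi_apply _).mul ?_).const_mul _
  exact (measurable_Phi_comp (measurable_pi_apply _) _ _ _ _).mul (measurable_pi_apply _)

variable {Ω : Type*} {mΩ : MeasurableSpace Ω} {μ : Measure Ω} [IsProbabilityMeasure μ]

/-- Moments of `B'` for one set of independent signals. -/
theorem memLp_matOf {X : ProcIndex n → Ω → ℝ} (hX : ∀ j, Measurable (X j)) (hind : iIndepFun X μ)
    (hx : MemLp (X (.inl ())) 4 μ) (hu : ∀ e, MemLp (X (.inr (.inl e))) 2 μ)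
    (q l : Fin n × Fin 2) :
    MemLp (fun ω => matOf α β γ (fun j => X j ω) q l) 2 μ ∧
      ∫ ω, matOf α β γ (fun j => X j ω) q l ∂μ =
        BbarMat α β γ (fun i j => ∫ ω, X (.inr (.inl (i, j))) ω ∂μ) (∫ ω, X (.inl ()) ω ∂μ)
          (∫ ω, X (.inl ()) ω ^ 2 ∂μ) q l := by
  obtain ⟨h1, h2⟩ := memLp_Phi hx (α q.1) (β q.1) q.2 l.2
  obtain ⟨h3, h4⟩ := memLp_Gam (fun i j => hu (i, j)) γ q.1 l.1
  -- `Φ` depends on the signal alone and `Γ` on the link indicators alone, so the mean of their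
  -- product factors into `B̄'`.
  have hi : IndepFun (fun ω => Phi (α q.1) (β q.1) (X (.inl ()) ω) q.2 l.2)
      (fun ω => Gam (fun i j => X (.inr (.inl (i, j))) ω * γ i j) q.1 l.1) μ := by
    refine indepFun_of_compl hX hind (.inl ())
      (measurable_Phi_comp (measurable_sigmaOf X (Set.mem_singleton _)) _ _ _ _) ?_
    refine measurable_Gam (fun i j => ?_) q.1 l.1
    exact (measurable_sigmaOf X (k := .inr (.inl (i, j))) (by simp)).mul_const _
  simp only [matOf_apply]
  refine ⟨(memLp_mul_of_indepFun h1 h3 hi).1, ?_⟩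
  rw [hi.integral_fun_mul_eq_mul_integral h1.aestronglyMeasurable h3.aestronglyMeasurable, h2, h4,
    BbarMat, blockDiag_kronecker_apply]

/-- Moments of `ν` for one set of independent signals. -/
theorem memLp_noiseOf {X : ProcIndex n → Ω → ℝ} (hX : ∀ j, Measurable (X j))
    (hind : iIndepFun X μ) (hx : MemLp (X (.inl ())) 4 μ)
    (hu : ∀ e, MemLp (X (.inr (.inl e))) 2 μ) (hξ : ∀ e, MemLp (X (.inr (.inr e))) 2 μ)
    (hξ0 : ∀ e, ∫ ω, X (.inr (.inr e)) ω ∂μ = 0) (q : Fin n × Fin 2) :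
    MemLp (fun ω => noiseOf α β γ (fun j => X j ω) q) 2 μ ∧
      ∫ ω, noiseOf α β γ (fun j => X j ω) q ∂μ = 0 := by
  obtain ⟨h1, -⟩ := memLp_Phi hx (α q.1) (β q.1) q.2 1
  have hm1 : Measurable[sigmaOf X {.inl ()}]
      fun ω => Phi (α q.1) (β q.1) (X (.inl ()) ω) q.2 1 :=
      measurable_Phi_comp (measurable_sigmaOf X (Set.mem_singleton _)) _ _ _ _
  have h2 : ∀ j, MemLp (fun ω => Phi (α q.1) (β q.1) (X (.inl ()) ω) q.2 1 *
      X (.inr (.inl (q.1, j))) ω) 2 μ := fun j =>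
    (memLp_mul_of_indepFun h1 (hu _) (indepFun_of_compl hX hind (.inl ()) hm1
      (measurable_sigmaOf X (k := .inr (.inl (q.1, j))) (by simp)))).1
  have hi : ∀ j, IndepFun (X (.inr (.inr (q.1, j)))) (fun ω =>
      Phi (α q.1) (β q.1) (X (.inl ()) ω) q.2 1 * X (.inr (.inl (q.1, j))) ω) μ := fun j => by
    refine indepFun_of_compl hX hind (.inr (.inr (q.1, j)))
      (measurable_sigmaOf X (Set.mem_singleton _)) ?_
    refine Measurable.mul ?_ (measurable_sigmaOf X (k := .inr (.inl (q.1, j))) (by simp))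
    exact measurable_Phi_comp (measurable_sigmaOf X (k := .inl ()) (by simp)) _ _ _ _
  simp only [noiseOf_apply]
  have h3 := fun j => (memLp_mul_of_indepFun (hξ (q.1, j)) (h2 j) (hi j)).1.const_mul (γ q.1 j)
  refine ⟨memLp_finsetSum _ fun j _ => h3 j, ?_⟩
  rw [integral_finsetSum _ fun j _ => (h3 j).integrable (by norm_num)]
  refine Finset.sum_eq_zero fun j _ => ?_
  rw [integral_const_mul, (hi j).integral_fun_mul_eq_mul_integral (hξ _).aestronglyMeasurable
    (h2 j).aestronglyMeasurable, hξ0, zero_mul, mul_zero]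

end Assembly

/-! ### Stochastic approximation driven by an i.i.d. sequence. -/

variable {Ω ι J : Type*} {mΩ : MeasurableSpace Ω} {μ : Measure Ω} [IsProbabilityMeasure μ]
  [Fintype ι] [DecidableEq ι] [Countable J]

/-- `linear_stochastic_approximation` for coefficients that are functions of an i.i.d. sequence of
vectors with independent components. -/
theorem linear_stochastic_approximation_of_iid {X : J → ℕ → Ω → ℝ} (hXm : ∀ j t, Measurable (X j t))
    (hXi : iIndepFun (fun k : J × ℕ => X k.1 k.2) μ)
    (hXd : ∀ t j, IdentDistrib (X j t) (X j 0) μ μ)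
    {F : (J → ℝ) → Matrix ι ι ℝ} {N : (J → ℝ) → ι → ℝ} (hFm : ∀ q l, Measurable fun s => F s q l)
    (hNm : ∀ q, Measurable fun s => N s q)
    (hF2 : ∀ q l, MemLp (fun ω => F (fun j => X j 0 ω) q l) 2 μ)
    (hN2 : ∀ q, MemLp (fun ω => N (fun j => X j 0 ω) q) 2 μ)
    (hF0 : ∀ q l, ∫ ω, F (fun j => X j 0 ω) q l ∂μ = 0)
    (hN0 : ∀ q, ∫ ω, N (fun j => X j 0 ω) q ∂μ = 0)
    {B P Q : Matrix ι ι ℝ} {c : ℝ} (hFP : ∀ s, F s * P = 0)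
    (hBP : B * P = 0) (hPB : P * B = 0) (hPP : P * P = P) (hc : 0 < c) (hQs : Q.IsSymm)
    (hQ1 : ∀ v, v ⬝ᵥ v ≤ v ⬝ᵥ Q *ᵥ v)
    (hQA : ∀ v, v ⬝ᵥ Q *ᵥ ((B - P) *ᵥ v) ≤ -c * (v ⬝ᵥ Q *ᵥ v)) {δ : ℕ → ℝ} (hδ : ∀ t, 0 < δ t)
    (hδsum : Tendsto (fun N => ∑ t ∈ Finset.range N, δ t) atTop atTop)
    (hδsq : Summable fun t => δ t ^ 2)
    {ρ : ℕ → Ω → ι → ℝ} {ρ₀ : ι → ℝ} (hρ0 : ∀ ω, ρ 0 ω = ρ₀)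
    (hρ : ∀ t ω, ρ (t + 1) ω = ρ t ω + δ t • (B *ᵥ ρ t ω +
      (F (fun j => X j t ω) *ᵥ ρ t ω + N (fun j => X j t ω)))) :
    (∀ t q, MemLp (fun ω => ρ t ω q) 2 μ) ∧
    ∃ L : Ω → ι → ℝ, (∀ q, Measurable fun ω => L ω q) ∧ (∀ q, MemLp (fun ω => L ω q) 2 μ) ∧
      (∀ q, ∫ ω, L ω q ∂μ = 0) ∧
      (∀ᵐ ω ∂μ, Tendsto (fun t => ρ t ω) atTop (𝓝 (P *ᵥ (ρ₀ + L ω)))) ∧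
      ∀ q, Tendsto (fun t => ∫ ω, (ρ t ω q - (P *ᵥ (ρ₀ + L ω)) q) ^ 2 ∂μ) atTop (𝓝 0) := by
  set Y : J × ℕ → Ω → ℝ := fun k => X k.1 k.2 with hY
  have hYm : ∀ k, Measurable (Y k) := fun k => hXm k.1 k.2
  have hslice : ∀ t, iIndepFun (fun j => X j t) μ := fun t =>
    hXi.precomp (g := fun j => (j, t)) fun a b h => congrArg Prod.fst h
  set ζ : ℕ → Ω → J → ℝ := fun t ω j => X j t ω with hζ
  have hζd : ∀ t, IdentDistrib (ζ t) (ζ 0) μ μ := fun t =>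
    IdentDistrib.pi (hXd t) (hslice t) (hslice 0)
  set now : ℕ → Set (J × ℕ) := fun t => {k | k.2 = t} with hnow
  have hζnow : ∀ t, Measurable[sigmaOf Y (now t)] (ζ t) := fun t =>
    @measurable_pi_lambda Ω J (fun _ => ℝ) (sigmaOf Y (now t)) _ _ fun j =>
      measurable_sigmaOf Y (k := (j, t)) rfl
  set ℱ := strictPast hYm with hℱ
  have hnow_le : ∀ t, sigmaOf Y (now t) ≤ ℱ (t + 1) := fun t =>
    biSup_mono fun k (hk : k.2 = t) => show k.2 < t + 1 by omega
  have hind : ∀ (t : ℕ) (f : (J → ℝ) → ℝ), Measurable f → ∀ Z : Ω → ℝ,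
      StronglyMeasurable[ℱ t] Z → IndepFun (fun ω => f (ζ t ω)) Z μ := by
    intro t f hf Z hZ
    refine indepFun_of_disjoint hYm hXi (S := now t) (T := {k | k.2 < t}) ?_
      (hf.comp (hζnow t)) hZ.measurable
    exact Set.disjoint_left.2 fun k (h1 : k.2 = t) (h2 : k.2 < t) => by omega
  have hFd : ∀ t q l, IdentDistrib (fun ω => F (ζ t ω) q l) (fun ω => F (ζ 0 ω) q l) μ μ :=
    fun t q l => (hζd t).comp (hFm q l)
  have hNd : ∀ t q, IdentDistrib (fun ω => N (ζ t ω) q)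
      (fun ω => N (ζ 0 ω) q) μ μ := fun t q => (hζd t).comp (hNm q)
  set C : ℝ := ∑ q, ∑ l, ∫ ω, F (ζ 0 ω) q l ^ 2 ∂μ + ∑ q, ∫ ω, N (ζ 0 ω) q ^ 2 ∂μ
  have hFnn : ∀ q l, 0 ≤ ∫ ω, F (ζ 0 ω) q l ^ 2 ∂μ := fun q l =>
    integral_nonneg fun _ => sq_nonneg _
  have hNnn : ∀ q, 0 ≤ ∫ ω, N (ζ 0 ω) q ^ 2 ∂μ := fun q =>
    integral_nonneg fun _ => sq_nonneg _
  have hFC : ∀ t q l, ∫ ω, F (ζ t ω) q l ^ 2 ∂μ ≤ C := by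
    intro t q l
    rw [(hFd t q l).sq.integral_eq]
    have h1 := Finset.single_le_sum (f := fun l => ∫ ω, F (ζ 0 ω) q l ^ 2 ∂μ)
      (fun l _ => hFnn q l) (Finset.mem_univ l)
    have h2 := Finset.single_le_sum (f := fun q => ∑ l, ∫ ω, F (ζ 0 ω) q l ^ 2 ∂μ)
      (fun q _ => Finset.sum_nonneg fun l _ => hFnn q l) (Finset.mem_univ q)
    exact (h1.trans h2).trans (le_add_of_nonneg_right (Finset.sum_nonneg fun q _ => hNnn q))
  have hNC : ∀ t q, ∫ ω, N (ζ t ω) q ^ 2 ∂μ ≤ C := by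
    intro t q
    rw [(hNd t q).sq.integral_eq]
    have h1 := Finset.single_le_sum (f := fun q => ∫ ω, N (ζ 0 ω) q ^ 2 ∂μ)
      (fun q _ => hNnn q) (Finset.mem_univ q)
    exact h1.trans (le_add_of_nonneg_left
      (Finset.sum_nonneg fun q _ => Finset.sum_nonneg fun l _ => hFnn q l))
  exact linear_stochastic_approximation (μ := μ) ℱ
    (D := fun t ω => F (ζ t ω)) (e := fun t ω => N (ζ t ω)) hBP hPB hPP hc hQs hQ1 hQA hδ hδsum hδsq
    hρ0
    -- Since `F s * P = 0`, inserting `1 - P` between `F` and the state changes nothing.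
    (fun t ω => by
      rw [hρ, Matrix.mulVec_mulVec, mul_sub, hFP, mul_one, sub_zero])
    (fun t q l => (((hFm q l).comp (hζnow t)).mono (hnow_le t) le_rfl).stronglyMeasurable)
    (fun t q => (((hNm q).comp (hζnow t)).mono (hnow_le t) le_rfl).stronglyMeasurable)
    (fun t q l => hind t _ (hFm q l)) (fun t q => hind t _ (hNm q))
    (fun t q l => (hFd t q l).memLp_iff.2 (hF2 q l)) (fun t q => (hNd t q).memLp_iff.2 (hN2 q))
    (fun t q l => (hFd t q l).integral_eq.trans (hF0 q l))
    (fun t q => (hNd t q).integral_eq.trans (hN0 q)) hFC hNC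

end BlindCalibration

/-! ### The convergence theorem. -/

open BlindCalibration

theorem theorem4 {Ω : Type*} [MeasurableSpace Ω] (μ : Measure Ω) [IsProbabilityMeasure μ]
    -- sensors, digraph (`G.Adj j i`: sensor `j` can send to sensor `i`), weights
    (n : ℕ) (α β : Fin n → ℝ) (hα : ∀ i, α i ≠ 0)
    (G : Digraph (Fin n)) (hG : BlindCalibration.HasSpanningTree G)
    (γ : Fin n → Fin n → ℝ)
    (hγ_pos : ∀ i j, G.Adj j i → 0 < γ i j) (hγ_zero : ∀ i j, ¬ G.Adj j i → γ i j = 0)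
    -- the signal: i.i.d. with positive variance
    (x : ℕ → Ω → ℝ) (hx_meas : ∀ t, Measurable (x t))
    (hx_indep : iIndepFun x μ) (hx_ident : ∀ t, IdentDistrib (x t) (x 0) μ μ)
    (hx_moment : MemLp (x 0) 4 μ)
    (xbar s2 : ℝ) (hxbar : xbar = ∫ ω, x 0 ω ∂μ) (hs2 : s2 = ∫ ω, x 0 ω ^ 2 ∂μ)
    (hvar : 0 < s2 - xbar ^ 2)
    -- communication dropouts
    (u : Fin n → Fin n → ℕ → Ω → ℝ) (hu_meas : ∀ i j t, Measurable (u i j t))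
    (hu_indep : ∀ i j, iIndepFun (u i j) μ)
    (p : Fin n → Fin n → ℝ) (hp : ∀ i j, G.Adj j i → 0 < p i j)
    (hu_one : ∀ i j t, μ.real {ω | u i j t ω = 1} = p i j)
    (hu_zero : ∀ i j t, μ.real {ω | u i j t ω = 0} = 1 - p i j)
    -- communication noise
    (ξ : Fin n → Fin n → ℕ → Ω → ℝ) (hξ_meas : ∀ i j t, Measurable (ξ i j t))
    (hξ_indep : ∀ i j, iIndepFun (ξ i j) μ)
    (hξ_ident : ∀ i j t, IdentDistrib (ξ i j t) (ξ i j 0) μ μ)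
    (hξ_moment : ∀ i j, MemLp (ξ i j 0) 2 μ) (hξ_mean : ∀ i j, ∫ ω, ξ i j 0 ω ∂μ = 0)
    -- mutual independence of all the processes
    (h_indep : iIndepFun (BlindCalibration.processes x u ξ) μ)
    -- step sizes
    (δ : ℕ → ℝ) (hδ_pos : ∀ t, 0 < δ t)
    (hδ_sum : Tendsto (fun N => ∑ t ∈ Finset.range N, δ t) atTop atTop)
    (hδ_sq : Summable fun t => δ t ^ 2)
    -- the estimates
    (ρ : ℕ → Ω → Fin n × Fin 2 → ℝ)
    (hρ : ∀ t ω, ρ t ω = BlindCalibration.rhoHat α β γ δ (fun s => x s ω)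
      (fun i j s => u i j s ω) (fun i j s => ξ i j s ω) t) :
    ∃ w : Fin 2 → Ω → ℝ,
      (∀ k, Measurable (w k)) ∧ (∀ k, MemLp (w k) 2 μ) ∧
      -- mean square convergence to `w₁ i₁ + w₂ i₂`
      (∀ t q, MemLp (fun ω => ρ t ω q) 2 μ) ∧
      Tendsto (fun t => ∫ ω, ∑ q,
          (ρ t ω q - ∑ k, w k ω * BlindCalibration.iVec n k q) ^ 2 ∂μ) atTop (𝓝 0) ∧
      -- convergence with probability one
      (∀ᵐ ω ∂μ, Tendsto (fun t => ρ t ω) atTop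
        (𝓝 (∑ k, w k ω • BlindCalibration.iVec n k))) ∧
      -- a matrix `T₀` with the column space of `B̄'` exists; for each such `T₀` the matrix
      -- `T' = [i₁ i₂ T₀]` is nonsingular, and the first two rows of its inverse `S`, which are
      -- left null vectors of `B̄'`, give the expectations of `w₁` and `w₂`
      (∃ T₀ : Matrix (Fin n × Fin 2) (Fin (2 * n - 2)) ℝ,
        Submodule.span ℝ (Set.range T₀.col) =
          Submodule.span ℝ (Set.range (BlindCalibration.BbarMat α β γ p xbar s2).col)) ∧
      ∀ T₀ : Matrix (Fin n × Fin 2) (Fin (2 * n - 2)) ℝ,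
        Submodule.span ℝ (Set.range T₀.col) =
          Submodule.span ℝ (Set.range (BlindCalibration.BbarMat α β γ p xbar s2).col) →
        ∃ S : Matrix (Fin 2 ⊕ Fin (2 * n - 2)) (Fin n × Fin 2) ℝ,
          S * BlindCalibration.transMat T₀ = 1 ∧ BlindCalibration.transMat T₀ * S = 1 ∧
          ∀ k : Fin 2,
            S.row (Sum.inl k) ᵥ* BlindCalibration.BbarMat α β γ p xbar s2 = 0 ∧
            ∫ ω, w k ω ∂μ = S.row (Sum.inl k) ⬝ᵥ BlindCalibration.rhoInit α β := by
  obtain ⟨T, hTG, r, -, -, hreach⟩ := hG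
  -- The root of the spanning tree is a vertex, so there is at least one sensor.
  have : NeZero n := ⟨fun h => by subst h; exact r.elim0⟩
  have hg : ∀ i j, 0 ≤ γ i j * p i j := fun i j => by
    by_cases h : G.Adj j i
    · exact (mul_pos (hγ_pos i j h) (hp i j h)).le
    · rw [hγ_zero i j h, zero_mul]
  have hpos : ∀ i j, T.Adj j i → 0 < γ i j * p i j := fun i j h =>
    mul_pos (hγ_pos i j (hTG h)) (hp i j (hTG h))
  obtain ⟨π, hkill, hdual, hT₀, hS⟩ := exists_left_eigenvectors (β := β) hα hvar hreach hg hpos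
  set B := BbarMat α β γ p xbar s2 with hB
  set P := consensusProj π with hP
  obtain ⟨Q, hQs, hQ1, c, hc, hQA⟩ := exists_lyapunov (B - P)
    (eq_zero_of_deflated_eigen hα hvar hreach hg hpos hkill hdual)
  have hBP : B * P = 0 := mul_consensusProj (fun k => BbarMat_mulVec_iVec k) π
  have hPB : P * B = 0 := consensusProj_mul hkill
  have hPP : P * P = P := consensusProj_mul_self hdual
  -- the joint family of all signals at all times
  set X : ProcIndex n → ℕ → Ω → ℝ := fun j t ω => processes x u ξ j ω t with hX
  have hXm : ∀ j t, Measurable (X j t) := by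
    rintro (_ | ⟨i, j⟩ | ⟨i, j⟩) t
    exacts [hx_meas t, hu_meas i j t, hξ_meas i j t]
  have hXi : ∀ j, iIndepFun (X j) μ := by
    rintro (_ | ⟨i, j⟩ | ⟨i, j⟩)
    exacts [hx_indep, hu_indep i j, hξ_indep i j]
  have hXd : ∀ t j, IdentDistrib (X j t) (X j 0) μ μ := by
    rintro t (_ | ⟨i, j⟩ | ⟨i, j⟩)
    · exact hx_ident t
    -- The two point probabilities add up to one, so they determine the law of the indicator.
    · refine ⟨(hu_meas i j t).aemeasurable, (hu_meas i j 0).aemeasurable, ?_⟩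
      exact (map_eq_of_zero_one (hu_meas i j t) (hu_one i j t) (hu_zero i j t)).trans
        (map_eq_of_zero_one (hu_meas i j 0) (hu_one i j 0) (hu_zero i j 0)).symm
    · exact hξ_ident i j t
  -- Independence between the processes and independence in time within each one combine into
  -- independence of the whole doubly indexed family.
  have hYi : iIndepFun (fun k : ProcIndex n × ℕ => X k.1 k.2) μ :=
    iIndepFun_uncurry' hXm h_indep hXi
  have hslice : iIndepFun (fun j => X j 0) μ :=
    hYi.precomp (g := fun j => (j, 0)) fun a b h => congrArg Prod.fst h
  -- moments of the coefficients
  have hu2 : ∀ e, MemLp (X (.inr (.inl e)) 0) 2 μ := fun e =>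
    memLp_of_zero_one (hu_meas e.1 e.2 0) (hu_one e.1 e.2 0) (hu_zero e.1 e.2 0)
  have hu1 : ∀ i j, ∫ ω, X (.inr (.inl (i, j))) 0 ω ∂μ = p i j := fun i j =>
    integral_of_zero_one (hu_meas i j 0) (hu_one i j 0) (hu_zero i j 0)
  have hmat := memLp_matOf (α := α) (β := β) (γ := γ) (X := fun j => X j 0) (fun j => hXm j 0)
    (hslice) hx_moment hu2
  have hnoise := memLp_noiseOf (α := α) (β := β) (γ := γ) (X := fun j => X j 0) (fun j => hXm j 0)
    (hslice) hx_moment hu2 (fun e => hξ_moment e.1 e.2) (fun e => hξ_mean e.1 e.2)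
  set F : (ProcIndex n → ℝ) → Matrix (Fin n × Fin 2) (Fin n × Fin 2) ℝ :=
    fun s => matOf α β γ s - B with hF
  have hFm : ∀ q l, Measurable fun s => F s q l := fun q l => (measurable_matOf q l).sub_const _
  have hF2 : ∀ q l, MemLp (fun ω => F (fun j => X j 0 ω) q l) 2 μ := fun q l =>
    (hmat q l).1.sub (memLp_const _)
  have hF0 : ∀ q l, ∫ ω, F (fun j => X j 0 ω) q l ∂μ = 0 := by
    intro q l
    have h1 : ∫ ω, matOf α β γ (fun j => X j 0 ω) q l ∂μ = B q l := by
      rw [hB, hxbar, hs2]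
      refine (hmat q l).2.trans ?_
      simp only [hu1]
      rfl
    simp only [hF, Matrix.sub_apply]
    rw [integral_sub ((hmat q l).1.integrable (by norm_num)) (integrable_const _), h1]
    simp
  -- Both `B'(t)` and its mean kill `i₁` and `i₂`, so the multiplicative noise vanishes at
  -- consensus.
  have hFP : ∀ s, F s * P = 0 := fun s => mul_consensusProj (fun k => by
    rw [hF, Matrix.sub_mulVec, hB, BbarMat_mulVec_iVec, matOf, Bmat_mulVec_iVec, sub_zero]) π
  have hstep : ∀ t ω, ρ (t + 1) ω = ρ t ω + δ t • (B *ᵥ ρ t ω +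
      (F (fun j => X j t ω) *ᵥ ρ t ω + noiseOf α β γ (fun j => X j t ω))) := by
    intro t ω
    rw [hρ, hρ, rhoHat_succ_split α β γ p xbar s2, Matrix.add_mulVec, Matrix.one_mulVec,
      Matrix.smul_mulVec, smul_add, smul_add, ← add_assoc, ← add_assoc]
    rfl
  obtain ⟨hρ2, L, hLm, hL2, hL0, hLae, hLms⟩ := linear_stochastic_approximation_of_iid (μ := μ)
    hXm hYi hXd hFm (fun q => measurable_noiseOf q) hF2 (fun q => (hnoise q).1) hF0
    (fun q => (hnoise q).2) hFP hBP hPB hPP hc hQs hQ1 hQA hδ_pos hδ_sum hδ_sq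
    (ρ₀ := rhoInit α β) (fun ω => by rw [hρ]; rfl) hstep
  have hlim : ∀ ω, P *ᵥ (rhoInit α β + L ω) = ∑ k, (π k ⬝ᵥ (rhoInit α β + L ω)) • iVec n k :=
    fun ω => consensusProj_mulVec π _
  have hlimq : ∀ ω q, ∑ k, (π k ⬝ᵥ (rhoInit α β + L ω)) * iVec n k q =
      (P *ᵥ (rhoInit α β + L ω)) q := fun ω q => by
    rw [hlim, Finset.sum_apply]
    rfl
  have hw2 : ∀ q, MemLp (fun ω => (rhoInit α β + L ω) q) 2 μ :=
    memLp_const_add hL2 _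
  have hterm : ∀ k q, MemLp (fun ω => π k q * (rhoInit α β + L ω) q) 2 μ := fun k q =>
    (hw2 q).const_mul _
  refine ⟨fun k ω => π k ⬝ᵥ (rhoInit α β + L ω), fun k => ?_, fun k => ?_, hρ2, ?_, ?_, hT₀, ?_⟩
  · exact Finset.measurable_fun_sum _ fun q _ => ((hLm q).const_add _).const_mul _
  · exact memLp_finsetSum _ fun q _ => hterm k q
  · simp only [hlimq]
    have hint : ∀ t q, Integrable (fun ω => (ρ t ω q - (P *ᵥ (rhoInit α β + L ω)) q) ^ 2) μ :=
      fun t q => ((hρ2 t q).sub (memLp_mulVec hw2 P q)).integrable_sq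
    have heq : ∀ t, ∫ ω, ∑ q, (ρ t ω q - (P *ᵥ (rhoInit α β + L ω)) q) ^ 2 ∂μ =
        ∑ q, ∫ ω, (ρ t ω q - (P *ᵥ (rhoInit α β + L ω)) q) ^ 2 ∂μ := fun t =>
      integral_finsetSum _ fun q _ => hint t q
    simp only [heq]
    simpa using tendsto_finsetSum Finset.univ fun q _ => hLms q
  · simpa only [hlim] using hLae
  · intro T₀ h
    obtain ⟨S, h1, h2, h3⟩ := hS T₀ h
    refine ⟨S, h1, h2, fun k => ?_⟩
    rw [h3]
    refine ⟨hkill k, ?_⟩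
    simp only [dotProduct]
    rw [integral_finsetSum _ fun q _ => (hterm k q).integrable (by norm_num)]
    refine Finset.sum_congr rfl fun q _ => ?_
    rw [integral_const_mul]
    congr 1
    simp only [Pi.add_apply]
    rw [integral_add (integrable_const _) ((hL2 q).integrable (by norm_num)), hL0]
    simp
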